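/- Fix an integer $k\ge 2$ and $\chi\in(0,1)$, and let $K=K(n)$ be the power of two closest to $n^\chi$. For $n\ge k$ let $(\pi_t)_{t\ge 0}$ be the continuous-time random walk on the symmetric group $\mathcal S_n$ driven by random $k$-cycles: $\pi_t=\pi_0\circ\gamma_1\circ\cdots\circ\gamma_{N_t}$, where $\gamma_1,\gamma_2,\dots$ are i.i.d. uniformly distributed on the $k$-cycles of $\mathcal S_n$, $(N_t)_{t\ge0}$ is a Poisson process of rate $1$, and the initial permutation $\pi_0$ (arbitrary, possibly random, not necessarily the identity), $(\gamma_i)_{i\ge 1}$ and $(N_t)_{t\ge 0}$ are independent. Let $N_i(t)$ be the number of cycles of size $i$ of $\pi_t$ (fixed points being cycles of size $1$), and for $j\ge0$ let $M_j(t)=\sum_{2^j\le i<2^{j+1}}N_i(t)$. Then $$\lim_{n\to\infty}\mathbb P\Bigl(\max_{t\in[k^{-1}n(\log n-\log\log n),\;n\log n]}\ \max_{0\le j\le \log_2K+1}M_j(t)>\tfrac12(\log n)^6\Bigr)=0 .$$ -/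

import Mathlib

open MeasureTheory ProbabilityTheory Filter Topology
open scoped NNReal ENNReal

namespace RandomKCycles

/-- Permutations of a finite set carry the discrete sigma-algebra. -/
instance permMeasurableSpace (n : ℕ) : MeasurableSpace (Equiv.Perm (Fin n)) := ⊤

/-- The conjugacy class of `k`-cycles in the symmetric group on `n` points. -/
def kCycles (k n : ℕ) : Set (Equiv.Perm (Fin n)) :=
  {σ | σ.IsCycle ∧ σ.support.card = k}

/-- `cycleCount σ i` is the number of cycles of size `i` of `σ`
(fixed points are the cycles of size `1`). -/
def cycleCount {n : ℕ} (σ : Equiv.Perm (Fin n)) (i : ℕ) : ℕ :=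
  σ.partition.parts.count i

/-- `stripCount σ j` is the number of cycles of `σ` with size in `[2^j, 2^(j+1))`. -/
def stripCount {n : ℕ} (σ : Equiv.Perm (Fin n)) (j : ℕ) : ℕ :=
  ∑ i ∈ Finset.Ico (2 ^ j) (2 ^ (j + 1)), cycleCount σ i

/-- `N` is a Poisson process with rate `1`: it starts at `0`, its paths are almost surely
nondecreasing and right-continuous, its increments are independent, and `N t - N s` has the
Poisson law of mean `t - s` for `s ≤ t`. -/
structure IsPoissonProcess {Ω : Type*} [MeasurableSpace Ω] (P : Measure Ω)
    (N : ℝ≥0 → Ω → ℕ) : Prop where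
  measurable : ∀ t, Measurable (N t)
  zero : ∀ᵐ ω ∂P, N 0 ω = 0
  monotone : ∀ᵐ ω ∂P, Monotone fun t => N t ω
  rightContinuous : ∀ᵐ ω ∂P, ∀ t, ContinuousWithinAt (fun s => N s ω) (Set.Ici t) t
  indepIncrements : HasIndepIncrements N P
  law : ∀ s t, s ≤ t → P.map (fun ω => N t ω - N s ω) = poissonMeasure (t - s)

/-- The data driving the rate-one random walk by `k`-cycles: a random initial permutation `π₀`,
i.i.d. uniform `k`-cycles `γ 0, γ 1, …` and a rate-one Poisson process `N`, all independent. -/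
structure IsWalkData {Ω : Type*} [MeasurableSpace Ω] (P : Measure Ω) (k n : ℕ)
    (π₀ : Ω → Equiv.Perm (Fin n)) (γ : ℕ → Ω → Equiv.Perm (Fin n))
    (N : ℝ≥0 → Ω → ℕ) : Prop where
  measurable_init : Measurable π₀
  measurable_step : ∀ i, Measurable (γ i)
  law_step : ∀ i, P.map (γ i) = uniformOn (kCycles k n)
  indep_steps : iIndepFun γ P
  poisson : IsPoissonProcess P N
  indep_clock : IndepFun (fun ω i => γ i ω) (fun ω t => N t ω) P
  indep_init : IndepFun π₀ (fun ω => ((fun i => γ i ω), fun t => N t ω)) P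

/-- The position at time `t` of the continuous-time walk: the initial permutation composed with
the first `N t` steps. -/
def walk {Ω : Type*} {n : ℕ} (π₀ : Ω → Equiv.Perm (Fin n))
    (γ : ℕ → Ω → Equiv.Perm (Fin n)) (N : ℝ≥0 → Ω → ℕ) (t : ℝ≥0) (ω : Ω) :
    Equiv.Perm (Fin n) :=
  π₀ ω * ((List.range (N t ω)).map fun i => γ i ω).prod

/-- `K` is a power of two that is closest to `x` among all powers of two
(in case of a tie, either of the two closest ones). -/
def IsClosestDyadic (K : ℕ) (x : ℝ) : Prop :=
  (∃ m : ℕ, K = 2 ^ m) ∧ ∀ m : ℕ, |(K : ℝ) - x| ≤ |(2 : ℝ) ^ m - x|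

end RandomKCycles

/-! Up to time `n log n` the walk makes polynomially many steps, and only polynomially many pairs
(number of steps `m`, strip `j`) occur. By Chebyshev and monotonicity of the clock, `m` lies, with
high probability throughout the interval, between `n (log n - log log n) / k - n` and `n log n + n`.
A union bound therefore reduces the claim to a tail of order `n ^ (-4)` for one strip after a
deterministic number `m` of steps, uniformly in the initial permutation
(`IsLarge.avg_stripCount_le`).

That tail comes from a moment of order about `log n`. Count the sequences of `r` distinct marked
cycles with sizes in the strip by revealing the permutation one image at a time along each cycle.
All images but the closing one are summed over for free. The closing image must be a prescribed
point, which has conditional probability at most `ε`, so each cycle costs a factor `n * 2 ^ j * ε`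
(`StepLaw.avg_explore_le`, `StepLaw.avg_cycleSeqs_le`). Conversely, many cycles force many such
sequences (`pow_le_cycleSeqs`).

The value of `ε` comes from `StepLaw.avg_reveals_and_le`. Condition on the whole trajectories of the
revealed points, not only on their images. A step that fixes all current positions of these points
is still symmetric under permutations of the other positions: it moves a further point with
probability at least `k / n`, and then to a uniform other free position. If the revealed
trajectories are moved `b` times, at least `m - b` steps are of this kind, whence `ε = 1 / (n - Q -
1) + (1 - k / n) ^ (m - b)`. The number `b` is kept small by an exponential moment: no trajectory is
moved more than about `(log n) ^ 2` times. For the `m` in question `n * ε = O(log n)`, so a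
threshold of order `(log n) ^ 2` already suffices. -/

namespace RandomKCycles

/-! ### Indicators and conjugation-invariant step laws -/

/-- The real indicator of a proposition. -/
noncomputable def ind (p : Prop) : ℝ := open Classical in if p then 1 else 0

lemma ind_of_true {p : Prop} (h : p) : ind p = 1 := by simp [ind, h]

lemma ind_of_false {p : Prop} (h : ¬ p) : ind p = 0 := by simp [ind, h]

lemma ind_nonneg (p : Prop) : 0 ≤ ind p := by unfold ind; split_ifs <;> norm_num

lemma ind_le_one (p : Prop) : ind p ≤ 1 := by unfold ind; split_ifs <;> norm_num

lemma ind_mono {p q : Prop} (h : p → q) : ind p ≤ ind q := by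
  by_cases hp : p
  · rw [ind_of_true hp, ind_of_true (h hp)]
  · rw [ind_of_false hp]; exact ind_nonneg q

lemma ind_congr {p q : Prop} (h : p ↔ q) : ind p = ind q := by rw [propext h]

lemma ind_and (p q : Prop) : ind (p ∧ q) = ind p * ind q := by
  by_cases hp : p <;> by_cases hq : q <;> simp [ind, hp, hq]

lemma sum_ind_eq {α : Type*} [Fintype α] (a : α) : ∑ b, ind (a = b) = 1 := by
  classical
  rw [Finset.sum_eq_single a]
  · exact ind_of_true rfl
  · intro b _ hb
    exact ind_of_false (Ne.symm hb)
  · simp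

variable {n : ℕ}

/-- A probability vector on permutations, invariant under conjugation and carried by the
permutations that move exactly `k` points. -/
structure StepLaw (k : ℕ) (u : Equiv.Perm (Fin n) → ℝ) : Prop where
  nonneg : ∀ g, 0 ≤ u g
  sum_eq_one : ∑ g, u g = 1
  conj : ∀ g h, u (h * g * h⁻¹) = u g
  card_support : ∀ g, u g ≠ 0 → g.support.card = k

lemma StepLaw.sum_conj {k : ℕ} {u : Equiv.Perm (Fin n) → ℝ} (hu : StepLaw k u)
    (h : Equiv.Perm (Fin n)) (φ : Equiv.Perm (Fin n) → ℝ) :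
    ∑ g, u g * φ g = ∑ g, u g * φ (h * g * h⁻¹) := by
  rw [← Equiv.sum_comp (MulAut.conj h).toEquiv (fun g => u g * φ g)]
  refine Finset.sum_congr rfl fun g _ => ?_
  simp [hu.conj]

/-- `fixProb u Z` is the probability that a step fixes every point of `Z`. -/
noncomputable def fixProb (u : Equiv.Perm (Fin n) → ℝ) (Z : Finset (Fin n)) : ℝ :=
  ∑ g, u g * ind (∀ x ∈ Z, g x = x)

/-- This is the symmetry behind the one-step probabilities: conditioning on fixing `Z` does not
distinguish the points outside `Z`. -/
lemma swap_conj_fixes_iff {Z : Finset (Fin n)} {a b : Fin n} (ha : a ∉ Z) (hb : b ∉ Z)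
    (g : Equiv.Perm (Fin n)) :
    (∀ x ∈ Z, (Equiv.swap a b * g * (Equiv.swap a b)⁻¹) x = x) ↔ ∀ x ∈ Z, g x = x := by
  refine forall₂_congr fun x hx => ?_
  have h1 : x ≠ a := fun h => ha (h ▸ hx)
  have h2 : x ≠ b := fun h => hb (h ▸ hx)
  simp only [Equiv.swap_inv, Equiv.Perm.mul_apply, Equiv.swap_apply_of_ne_of_ne h1 h2]
  rw [Equiv.swap_apply_eq_iff, Equiv.swap_apply_of_ne_of_ne h1 h2]

lemma StepLaw.card_moved {k : ℕ} {u : Equiv.Perm (Fin n) → ℝ} (hu : StepLaw k u)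
    {g : Equiv.Perm (Fin n)} (hg : u g ≠ 0) {Z : Finset (Fin n)} (hZ : ∀ x ∈ Z, g x = x) :
    ∑ z ∈ Zᶜ, ind (g z ≠ z) = k := by
  have hind : ∀ z, ind (g z ≠ z) = if g z ≠ z then 1 else 0 := fun z => by
    by_cases h : g z = z <;> simp [ind, h]
  rw [← hu.card_support g hg, Finset.sum_congr rfl fun z _ => hind z, Finset.sum_boole]
  congr 2
  ext x
  simp only [Finset.mem_filter, Finset.mem_compl, Equiv.Perm.mem_support]
  exact ⟨fun h => h.2, fun h => ⟨fun hx => h (hZ x hx), h⟩⟩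

/-- Given that a step fixes `Z`, it moves a further point with probability `k / |Zᶜ|`. -/
lemma StepLaw.prob_move {k : ℕ} {u : Equiv.Perm (Fin n) → ℝ} (hu : StepLaw k u)
    {Z : Finset (Fin n)} {z : Fin n} (hz : z ∉ Z) :
    ∑ g, u g * (ind (∀ x ∈ Z, g x = x) * ind (g z ≠ z)) =
      k / (Zᶜ.card : ℝ) * fixProb u Z := by
  have hsym : ∀ z' ∈ Zᶜ, ∑ g, u g * (ind (∀ x ∈ Z, g x = x) * ind (g z' ≠ z')) =
      ∑ g, u g * (ind (∀ x ∈ Z, g x = x) * ind (g z ≠ z)) := by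
    intro z' hz'
    rw [Finset.mem_compl] at hz'
    rw [hu.sum_conj (Equiv.swap z' z)]
    refine Finset.sum_congr rfl fun g _ => ?_
    rw [ind_congr (swap_conj_fixes_iff hz' hz g)]
    congr 2
    apply ind_congr
    simp only [Equiv.swap_inv, Equiv.Perm.mul_apply, Equiv.swap_apply_left, ne_eq]
    rw [Equiv.swap_apply_eq_iff, Equiv.swap_apply_left]
  have hpos : (0 : ℝ) < Zᶜ.card := by
    exact_mod_cast Finset.card_pos.mpr ⟨z, Finset.mem_compl.mpr hz⟩
  -- Double counting: a step that fixes `Z` moves exactly `k` points, all of them in `Zᶜ`, and by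
  -- `hsym` these points are equally likely to be moved.
  have hsum : (Zᶜ.card : ℝ) * ∑ g, u g * (ind (∀ x ∈ Z, g x = x) * ind (g z ≠ z)) =
      k * fixProb u Z := by
    rw [← nsmul_eq_mul, ← Finset.sum_const, ← Finset.sum_congr rfl hsym, Finset.sum_comm, fixProb,
      Finset.mul_sum]
    refine Finset.sum_congr rfl fun g _ => ?_
    rw [← Finset.mul_sum, ← Finset.mul_sum]
    by_cases hg : u g = 0
    · simp [hg]
    by_cases hZ : ∀ x ∈ Z, g x = x
    · rw [hu.card_moved hg hZ]; ring
    · rw [ind_of_false hZ]; ring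
  rw [div_mul_eq_mul_div, eq_div_iff hpos.ne', mul_comm, hsum]

/-- Given that a step fixes `Z`, it maps one further point to another one with probability
`k / (|Zᶜ| (|Zᶜ| - 1))`. -/
lemma StepLaw.prob_map {k : ℕ} {u : Equiv.Perm (Fin n) → ℝ} (hu : StepLaw k u)
    {Z : Finset (Fin n)} {z z' : Fin n} (hz : z ∉ Z) (hz' : z' ∉ Z) (hne : z' ≠ z) :
    ∑ g, u g * (ind (∀ x ∈ Z, g x = x) * ind (g z' = z)) =
      k / ((Zᶜ.card : ℝ) * (Zᶜ.card - 1)) * fixProb u Z := by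
  have hsym : ∀ a ∈ Zᶜ.erase z, ∑ g, u g * (ind (∀ x ∈ Z, g x = x) * ind (g a = z)) =
      ∑ g, u g * (ind (∀ x ∈ Z, g x = x) * ind (g z' = z)) := by
    intro a ha
    rw [Finset.mem_erase, Finset.mem_compl] at ha
    rw [hu.sum_conj (Equiv.swap a z')]
    refine Finset.sum_congr rfl fun g _ => ?_
    rw [ind_congr (swap_conj_fixes_iff ha.2 hz' g)]
    congr 2
    apply ind_congr
    simp only [Equiv.swap_inv, Equiv.Perm.mul_apply, Equiv.swap_apply_left]
    rw [Equiv.swap_apply_eq_iff, Equiv.swap_apply_of_ne_of_ne ha.1.symm hne.symm]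
  have hzc : z ∈ Zᶜ := Finset.mem_compl.mpr hz
  have hcard : ((Zᶜ.erase z).card : ℝ) = Zᶜ.card - 1 := by
    rw [Finset.card_erase_of_mem hzc, Nat.cast_pred (Finset.card_pos.mpr ⟨z, hzc⟩)]
  have hpos : (0 : ℝ) < (Zᶜ.erase z).card := by
    exact_mod_cast Finset.card_pos.mpr ⟨z', Finset.mem_erase.mpr ⟨hne, Finset.mem_compl.mpr hz'⟩⟩
  have hpos' : (0 : ℝ) < Zᶜ.card := by
    exact_mod_cast Finset.card_pos.mpr ⟨z, hzc⟩
  -- If `z` is moved, it has exactly one preimage, which is neither `z` nor a point of the fixed set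
  -- `Z`; so the sum over the candidates is the probability that `z` is moved.
  have hsum : ((Zᶜ.erase z).card : ℝ) *
      ∑ g, u g * (ind (∀ x ∈ Z, g x = x) * ind (g z' = z)) =
      ∑ g, u g * (ind (∀ x ∈ Z, g x = x) * ind (g z ≠ z)) := by
    rw [← nsmul_eq_mul, ← Finset.sum_const, ← Finset.sum_congr rfl hsym, Finset.sum_comm]
    refine Finset.sum_congr rfl fun g _ => ?_
    rw [← Finset.mul_sum, ← Finset.mul_sum]
    by_cases hZ : ∀ x ∈ Z, g x = x
    swap
    · rw [ind_of_false hZ]; ring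
    congr 2
    have hb : ∀ a, ind (g a = z) = ind (g⁻¹ z = a) := fun a => ind_congr (by
      rw [Equiv.Perm.inv_eq_iff_eq, eq_comm])
    by_cases hgz : g z = z
    · rw [ind_of_false (not_not.mpr hgz)]
      refine Finset.sum_eq_zero fun a ha => ind_of_false fun h => ?_
      exact (Finset.mem_erase.mp ha).1 (g.injective (h.trans hgz.symm))
    · rw [ind_of_true hgz, Finset.sum_eq_single (g⁻¹ z)]
      · exact ind_of_true (by simp)
      · intro a _ ha
        rw [hb]
        exact ind_of_false (Ne.symm ha)
      · intro h
        refine (h (Finset.mem_erase.mpr ⟨?_, Finset.mem_compl.mpr ?_⟩)).elim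
        · intro h'
          rw [Equiv.Perm.inv_eq_iff_eq] at h'
          exact hgz h'.symm
        · intro h'
          have := hZ _ h'
          rw [← Equiv.Perm.mul_apply, mul_inv_cancel, Equiv.Perm.one_apply] at this
          exact hz (this ▸ h')
  rw [hu.prob_move hz, hcard] at hsum
  rw [hcard] at hpos
  rw [div_mul_eq_mul_div, eq_div_iff (mul_pos hpos' hpos).ne']
  rw [div_mul_eq_mul_div, eq_div_iff hpos'.ne'] at hsum
  linarith

/-! ### Averages over step sequences and the number of moves of a trajectory -/

/-- The expectation of `f (γ₀, …, γ_{m-1})` for independent steps with law `u`. -/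
noncomputable def avg (u : Equiv.Perm (Fin n) → ℝ) :
    ℕ → (List (Equiv.Perm (Fin n)) → ℝ) → ℝ
  | 0, f => f []
  | m + 1, f => ∑ g, u g * avg u m (fun w => f (g :: w))

section avg

variable {k : ℕ} {u : Equiv.Perm (Fin n) → ℝ}

lemma avg_succ (m : ℕ) (f : List (Equiv.Perm (Fin n)) → ℝ) :
    avg u (m + 1) f = ∑ g, u g * avg u m (fun w => f (g :: w)) := rfl

lemma StepLaw.avg_mono (hu : StepLaw k u) (m : ℕ) {f f' : List (Equiv.Perm (Fin n)) → ℝ}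
    (h : ∀ w, f w ≤ f' w) : avg u m f ≤ avg u m f' := by
  induction m generalizing f f' with
  | zero => exact h []
  | succ m ih =>
    exact Finset.sum_le_sum fun g _ =>
      mul_le_mul_of_nonneg_left (ih fun w => h (g :: w)) (hu.nonneg g)

lemma avg_sum {ι : Type*} (s : Finset ι) (m : ℕ) (f : ι → List (Equiv.Perm (Fin n)) → ℝ) :
    avg u m (fun w => ∑ i ∈ s, f i w) = ∑ i ∈ s, avg u m (f i) := by
  induction m generalizing f with
  | zero => rfl
  | succ m ih =>
    simp only [avg_succ, ih, Finset.mul_sum]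
    exact Finset.sum_comm

lemma avg_const_mul (c : ℝ) (m : ℕ) (f : List (Equiv.Perm (Fin n)) → ℝ) :
    avg u m (fun w => c * f w) = c * avg u m f := by
  induction m generalizing f with
  | zero => rfl
  | succ m ih =>
    simp only [avg_succ, ih, Finset.mul_sum]
    exact Finset.sum_congr rfl fun g _ => by ring

lemma avg_zero (m : ℕ) : avg u m (fun _ => 0) = 0 := by
  simpa using avg_const_mul (u := u) 0 m (fun _ => 0)

lemma StepLaw.avg_one (hu : StepLaw k u) (m : ℕ) : avg u m (fun _ => 1) = 1 := by
  induction m with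
  | zero => rfl
  | succ m ih => simp [avg_succ, ih, hu.sum_eq_one]

lemma StepLaw.avg_nonneg (hu : StepLaw k u) (m : ℕ) {f : List (Equiv.Perm (Fin n)) → ℝ}
    (h : ∀ w, 0 ≤ f w) : 0 ≤ avg u m f := by
  rw [← avg_zero (u := u) m]
  exact hu.avg_mono m h

end avg

/-- The number of steps that move the trajectory of `x` when the steps of a list are applied
successively, the last one first. -/
def touches : List (Equiv.Perm (Fin n)) → Fin n → ℕ
  | [], _ => 0
  | g :: w, x => touches w x + if g (w.prod x) = w.prod x then 0 else 1

/-- The moments of `2 ^ touches`: each step moves a given point with probability `k / n`. -/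
lemma StepLaw.avg_two_pow_touches {k : ℕ} {u : Equiv.Perm (Fin n) → ℝ} (hu : StepLaw k u)
    (m : ℕ) (x : Fin n) :
    avg u m (fun w => 2 ^ touches w x) = (1 + k / n : ℝ) ^ m := by
  induction m with
  | zero => simp [avg, touches]
  | succ m ih =>
    have hmove : ∀ z : Fin n, ∑ g, u g * ind (g z ≠ z) = k / n := by
      intro z
      have := hu.prob_move (Finset.notMem_empty z)
      simp only [Finset.notMem_empty, false_imp_iff, imp_true_iff, ind_of_true trivial, one_mul,
        Finset.compl_empty, Finset.card_univ, Fintype.card_fin, fixProb, mul_one,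
        hu.sum_eq_one] at this
      exact this
    have hstep : ∀ g (w : List (Equiv.Perm (Fin n))), (2 : ℝ) ^ touches (g :: w) x =
        2 ^ touches w x * (1 + ind (g (w.prod x) ≠ w.prod x)) := by
      intro g w
      by_cases h : g (w.prod x) = w.prod x
      · simp [touches, h, ind]
      · simp only [touches, h, if_false, pow_succ, ind_of_true, ne_eq, not_false_eq_true]
        ring
    -- The head of the list acts last on `x`. Averaging it with the other steps frozen gives the
    -- factor `1 + k / n` whatever the current position `w.prod x` is.
    calc avg u (m + 1) (fun w => 2 ^ touches w x)
        = avg u m (fun w => ∑ g, u g * (2 ^ touches w x *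
            (1 + ind (g (w.prod x) ≠ w.prod x)))) := by
          simp only [avg_succ, hstep]
          rw [avg_sum]
          exact Finset.sum_congr rfl fun g _ => (avg_const_mul _ _ _).symm
      _ = avg u m (fun w => (1 + k / n : ℝ) * 2 ^ touches w x) := by
          congr 1
          ext w
          have : ∀ g, u g * (2 ^ touches w x * (1 + ind (g (w.prod x) ≠ w.prod x))) =
              2 ^ touches w x * (u g + u g * ind (g (w.prod x) ≠ w.prod x)) :=
            fun g => by ring
          rw [Finset.sum_congr rfl fun g _ => this g, ← Finset.mul_sum, Finset.sum_add_distrib,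
            hu.sum_eq_one, hmove]
          ring
      _ = (1 + k / n : ℝ) ^ (m + 1) := by
          rw [avg_const_mul, ih]
          ring

/-! ### The law of one further point given the trajectories of a set -/

/-- The points of `Y` are mapped as prescribed by `d`, and their trajectories are moved `b` times
altogether. -/
def Reveals (Y : Finset (Fin n)) (d : Fin n → Fin n) (b : ℕ) (w : List (Equiv.Perm (Fin n))) :
    Prop :=
  (∀ x ∈ Y, w.prod x = d x) ∧ ∑ x ∈ Y, touches w x = b

/-- The number of points of `Y` whose image under `d` is moved by `g`. -/
def movedCount (Y : Finset (Fin n)) (d : Fin n → Fin n) (g : Equiv.Perm (Fin n)) : ℕ :=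
  ∑ x ∈ Y, if g (g⁻¹ (d x)) = g⁻¹ (d x) then 0 else 1

/-- Just before `g` acts, the points of `Y` sit at `g⁻¹ (d x)`, so `g` uses up `movedCount Y d g` of
the `b` moves. The inequality guards the truncated subtraction. -/
lemma reveals_cons_iff {Y : Finset (Fin n)} {d : Fin n → Fin n} {b : ℕ}
    {g : Equiv.Perm (Fin n)} {w : List (Equiv.Perm (Fin n))} :
    Reveals Y d b (g :: w) ↔
      movedCount Y d g ≤ b ∧ Reveals Y (fun x => g⁻¹ (d x)) (b - movedCount Y d g) w := by
  have h1 : (∀ x ∈ Y, (g :: w).prod x = d x) ↔ ∀ x ∈ Y, w.prod x = g⁻¹ (d x) := by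
    refine forall₂_congr fun x _ => ?_
    rw [List.prod_cons, Equiv.Perm.mul_apply, Equiv.Perm.eq_inv_iff_eq]
  unfold Reveals
  rw [h1]
  have h2 : (∀ x ∈ Y, w.prod x = g⁻¹ (d x)) →
      ∑ x ∈ Y, touches (g :: w) x = ∑ x ∈ Y, touches w x + movedCount Y d g := by
    intro h
    rw [movedCount, ← Finset.sum_add_distrib]
    refine Finset.sum_congr rfl fun x hx => ?_
    rw [touches, h x hx]
  constructor
  · rintro ⟨h, hb⟩
    rw [h2 h] at hb
    exact ⟨by omega, h, by omega⟩
  · rintro ⟨hle, h, hb⟩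
    rw [h2 h]
    exact ⟨h, by omega⟩

lemma movedCount_eq_zero_iff {Y : Finset (Fin n)} {d : Fin n → Fin n} {g : Equiv.Perm (Fin n)} :
    movedCount Y d g = 0 ↔ ∀ z ∈ Y.image d, g z = z := by
  simp only [movedCount, Finset.sum_eq_zero_iff, Finset.forall_mem_image]
  refine forall₂_congr fun x _ => ?_
  have : g (g⁻¹ (d x)) = g⁻¹ (d x) ↔ g (d x) = d x := by
    rw [← Equiv.Perm.mul_apply, mul_inv_cancel, Equiv.Perm.one_apply, Equiv.Perm.eq_inv_iff_eq]
  rw [← this]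
  by_cases h : g (g⁻¹ (d x)) = g⁻¹ (d x)
  · rw [if_pos h]; exact iff_of_true rfl h
  · rw [if_neg h]; exact iff_of_false one_ne_zero h

/-- Averaging a nonnegative vector over the preimages of a point under a step that fixes `Z`. -/
lemma StepLaw.sum_fix_le {k : ℕ} {u : Equiv.Perm (Fin n) → ℝ} (hu : StepLaw k u)
    {Z : Finset (Fin n)} {z : Fin n} {a : Fin n → ℝ} (ha : ∀ y, 0 ≤ a y)
    (haZ : ∀ y ∈ Z, a y = 0) (hN : 2 ≤ Zᶜ.card) (hk : k ≤ Zᶜ.card) :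
    ∑ g, u g * (ind (∀ x ∈ Z, g x = x) * a (g⁻¹ z)) ≤
      fixProb u Z * ((1 - k / Zᶜ.card) * a z +
        k / ((Zᶜ.card : ℝ) * (Zᶜ.card - 1)) * ∑ y, a y) := by
  have hN2 : (2 : ℝ) ≤ Zᶜ.card := by exact_mod_cast hN
  have hkN : (k : ℝ) ≤ Zᶜ.card := by exact_mod_cast hk
  have hF : 0 ≤ fixProb u Z :=
    Finset.sum_nonneg fun g _ => mul_nonneg (hu.nonneg g) (ind_nonneg _)
  have hc : 0 ≤ (k : ℝ) / ((Zᶜ.card : ℝ) * (Zᶜ.card - 1)) :=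
    div_nonneg (Nat.cast_nonneg k) (mul_nonneg (by linarith) (by linarith))
  have hρ : 0 ≤ 1 - (k : ℝ) / Zᶜ.card := by
    rw [sub_nonneg, div_le_one (by linarith)]; exact hkN
  have hexp : ∀ g : Equiv.Perm (Fin n), a (g⁻¹ z) = ∑ y, ind (g y = z) * a y := by
    intro g
    rw [Finset.sum_eq_single (g⁻¹ z)]
    · rw [ind_of_true, one_mul]
      rw [← Equiv.Perm.mul_apply, mul_inv_cancel, Equiv.Perm.one_apply]
    · intro y _ hy
      rw [ind_of_false, zero_mul]
      exact fun h => hy (Equiv.Perm.eq_inv_iff_eq.mpr h)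
    · simp
  have hlhs : ∑ g, u g * (ind (∀ x ∈ Z, g x = x) * a (g⁻¹ z)) =
      ∑ y, a y * ∑ g, u g * (ind (∀ x ∈ Z, g x = x) * ind (g y = z)) := by
    simp only [hexp, Finset.mul_sum]
    rw [Finset.sum_comm]
    exact Finset.sum_congr rfl fun y _ => Finset.sum_congr rfl fun g _ => by ring
  rw [hlhs]
  by_cases hz : z ∈ Z
  -- If `z` lies in `Z`, a step that fixes `Z` has `z` itself as the preimage of `z`, and there `a`
  -- vanishes.
  · rw [Finset.sum_eq_zero]
    · exact mul_nonneg hF (add_nonneg (mul_nonneg hρ (ha z))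
        (mul_nonneg hc (Finset.sum_nonneg fun y _ => ha y)))
    · intro y _
      by_cases hy : y ∈ Z
      · rw [haZ y hy, zero_mul]
      · rw [Finset.sum_eq_zero, mul_zero]
        intro g _
        by_cases hg : ∀ x ∈ Z, g x = x
        · rw [ind_of_false (p := g y = z), mul_zero, mul_zero]
          exact fun h => hy (g.injective (h.trans (hg z hz).symm) ▸ hz)
        · rw [ind_of_false hg, zero_mul, mul_zero]
  · have hstay : ∑ g, u g * (ind (∀ x ∈ Z, g x = x) * ind (g z = z)) =
        (1 - k / Zᶜ.card) * fixProb u Z := by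
      have h1 := hu.prob_move hz
      have h2 : ∑ g, u g * (ind (∀ x ∈ Z, g x = x) * ind (g z = z)) +
          ∑ g, u g * (ind (∀ x ∈ Z, g x = x) * ind (g z ≠ z)) = fixProb u Z := by
        rw [← Finset.sum_add_distrib, fixProb]
        refine Finset.sum_congr rfl fun g _ => ?_
        by_cases h : g z = z <;> simp [ind, h]
      rw [h1] at h2
      linarith
    rw [← Finset.add_sum_erase _ _ (Finset.mem_univ z), hstay]
    -- The summand at `y = z` is added back for free, so that the total mass of `a` appears.
    have hrest : ∑ y ∈ Finset.univ.erase z,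
        a y * ∑ g, u g * (ind (∀ x ∈ Z, g x = x) * ind (g y = z)) ≤
        ∑ y, a y * (k / ((Zᶜ.card : ℝ) * (Zᶜ.card - 1)) * fixProb u Z) := by
      refine (Finset.sum_le_sum fun y hy => ?_).trans
        (Finset.sum_le_sum_of_subset_of_nonneg (Finset.erase_subset _ _) fun y _ _ =>
          mul_nonneg (ha y) (mul_nonneg hc hF))
      by_cases hyZ : y ∈ Z
      · rw [haZ y hyZ, zero_mul, zero_mul]
      · rw [hu.prob_map hz hyZ (Finset.ne_of_mem_erase hy)]
    rw [← Finset.sum_mul] at hrest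
    nlinarith [hrest]

/-- Conditionally on the trajectories of a set `Y` of points, which are moved `b` times, a further
point reaches a given position with small probability. -/
theorem StepLaw.avg_reveals_and_le {k : ℕ} {u : Equiv.Perm (Fin n) → ℝ} (hu : StepLaw k u)
    (hk : 2 ≤ k) {Q : ℕ} (hQ : Q + k ≤ n) {Y : Finset (Fin n)} (hY : Y.card ≤ Q) {y : Fin n}
    (hy : y ∉ Y) (m : ℕ) (d : Fin n → Fin n) (b : ℕ) (z : Fin n) :
    avg u m (fun w => ind (Reveals Y d b w ∧ w.prod y = z)) ≤
      (1 / ((n : ℝ) - Q - 1) + (1 - k / n : ℝ) ^ (m - b)) *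
        avg u m (fun w => ind (Reveals Y d b w)) := by
  have hQn : (Q : ℝ) + k ≤ n := by exact_mod_cast hQ
  have hk2 : (2 : ℝ) ≤ k := by exact_mod_cast hk
  have hM : 0 < (n : ℝ) - Q - 1 := by linarith
  have hn : (0 : ℝ) < n := by have : (0 : ℝ) ≤ Q := Q.cast_nonneg; linarith
  have hρ0 : 0 ≤ 1 - (k : ℝ) / n := by
    rw [sub_nonneg, div_le_one hn]; linarith [(Q.cast_nonneg : (0 : ℝ) ≤ Q)]
  have hρ1 : 1 - (k : ℝ) / n ≤ 1 := by
    have : 0 ≤ (k : ℝ) / n := by positivity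
    linarith
  induction m generalizing d b z with
  | zero =>
    -- Without steps the power is `1`, so the factor is at least `1`.
    simp only [avg, zero_tsub, pow_zero]
    have h1 := ind_mono (p := Reveals Y d b [] ∧ ([] : List (Equiv.Perm (Fin n))).prod y = z)
      (fun h => h.1)
    have h2 := ind_nonneg (Reveals Y d b [])
    have h3 : 0 < 1 / ((n : ℝ) - Q - 1) := by positivity
    nlinarith
  | succ m ih =>
    rw [avg_succ, avg_succ]
    set Z := Y.image d with hZ
    have hA0 : ∀ d' b', 0 ≤ avg u m (fun w => ind (Reveals Y d' b' w)) :=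
      fun d' b' => hu.avg_nonneg m fun w => ind_nonneg _
    have hbound0 : ∀ j : ℕ, 0 ≤ 1 / ((n : ℝ) - Q - 1) + (1 - k / n : ℝ) ^ j :=
      fun j => by positivity
    have hclose : ∀ g : Equiv.Perm (Fin n), ∀ w : List (Equiv.Perm (Fin n)),
        (g :: w).prod y = z ↔ w.prod y = g⁻¹ z := fun g w => by
      rw [List.prod_cons, Equiv.Perm.mul_apply, Equiv.Perm.eq_inv_iff_eq]
    have hsplit : ∀ φ : Equiv.Perm (Fin n) → ℝ, ∑ g, u g * φ g =
        ∑ g, u g * (ind (∀ x ∈ Z, g x = x) * φ g) +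
        ∑ g, u g * (ind (¬ ∀ x ∈ Z, g x = x) * φ g) := by
      intro φ
      rw [← Finset.sum_add_distrib]
      refine Finset.sum_congr rfl fun g _ => ?_
      by_cases h : ∀ x ∈ Z, g x = x
      · rw [ind_of_true h, ind_of_false (not_not.mpr h)]; ring
      · rw [ind_of_false h, ind_of_true h]; ring
    -- The step acting last is either clean, fixing the final positions `Z` of `Y`, or it moves one
    -- of them. Clean steps mix the position of `y`; the others use up part of `b`.
    rw [hsplit, hsplit (fun g => avg u m fun w => ind (Reveals Y d b (g :: w))), mul_add]
    refine add_le_add ?_ ?_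
    · set A := avg u m (fun w => ind (Reveals Y d b w)) with hA
      set a : Fin n → ℝ := fun v => avg u m (fun w => ind (Reveals Y d b w ∧ w.prod y = v))
        with ha
      have hfix : ∀ g : Equiv.Perm (Fin n), (∀ x ∈ Z, g x = x) → ∀ w,
          (Reveals Y d b (g :: w) ↔ Reveals Y d b w) := by
        intro g hg w
        rw [reveals_cons_iff, movedCount_eq_zero_iff.mpr hg]
        have : ∀ x ∈ Y, g⁻¹ (d x) = d x := fun x hx => by
          rw [Equiv.Perm.inv_eq_iff_eq, hg (d x) (Finset.mem_image_of_mem d hx)]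
        simp only [Reveals, Nat.zero_le, true_and, tsub_zero]
        refine and_congr_left fun _ => forall₂_congr fun x hx => ?_
        rw [this x hx]
      have hl : ∑ g, u g * (ind (∀ x ∈ Z, g x = x) *
          avg u m fun w => ind (Reveals Y d b (g :: w) ∧ (g :: w).prod y = z)) =
          ∑ g, u g * (ind (∀ x ∈ Z, g x = x) * a (g⁻¹ z)) := by
        refine Finset.sum_congr rfl fun g _ => ?_
        by_cases hg : ∀ x ∈ Z, g x = x
        · congr 2
          simp only [ha, hclose, hfix g hg]
        · rw [ind_of_false hg, zero_mul, zero_mul]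
      have hr : ∑ g, u g * (ind (∀ x ∈ Z, g x = x) *
          avg u m fun w => ind (Reveals Y d b (g :: w))) = fixProb u Z * A := by
        rw [fixProb, Finset.sum_mul]
        refine Finset.sum_congr rfl fun g _ => ?_
        by_cases hg : ∀ x ∈ Z, g x = x
        · simp only [hfix g hg, ← hA, mul_assoc]
        · rw [ind_of_false hg, zero_mul, mul_zero, zero_mul]
      have ha0 : ∀ v, 0 ≤ a v := fun v => hu.avg_nonneg m fun w => ind_nonneg _
      -- By injectivity `y` cannot sit where a point of `Y` sits.
      have haZ : ∀ v ∈ Z, a v = 0 := by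
        intro v hv
        obtain ⟨x, hx, rfl⟩ := Finset.mem_image.mp hv
        rw [← avg_zero (u := u) m]
        simp only [ha]
        congr 1
        ext w
        refine ind_of_false fun h => ?_
        have := h.1.1 x hx
        rw [← h.2] at this
        exact hy (w.prod.injective this ▸ hx)
      have hasum : ∑ v, a v = A := by
        simp only [ha, hA]
        rw [← avg_sum]
        congr 1
        ext w
        simp only [ind_and]
        rw [← Finset.mul_sum, sum_ind_eq, mul_one]
      have hcardZ : Z.card ≤ Q := Finset.card_image_le.trans hY
      have hZc : Zᶜ.card + Z.card = n := by
        rw [Finset.card_compl, Fintype.card_fin]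
        exact Nat.sub_add_cancel (by omega)
      have hN2 : 2 ≤ Zᶜ.card := by omega
      have hkN : k ≤ Zᶜ.card := by omega
      have hF : 0 ≤ fixProb u Z :=
        Finset.sum_nonneg fun g _ => mul_nonneg (hu.nonneg g) (ind_nonneg _)
      rw [hl, hr]
      refine (hu.sum_fix_le ha0 haZ hN2 hkN).trans ?_
      rw [hasum]
      have hNM : (n : ℝ) - Q - 1 ≤ (Zᶜ.card : ℝ) - 1 := by
        have h1 : ((Zᶜ.card : ℝ) + Z.card) = n := by exact_mod_cast hZc
        have h2 : (Z.card : ℝ) ≤ Q := by exact_mod_cast hcardZ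
        linarith
      have hNn : (Zᶜ.card : ℝ) ≤ n := by
        have h1 : ((Zᶜ.card : ℝ) + Z.card) = n := by exact_mod_cast hZc
        linarith [(Z.card.cast_nonneg : (0 : ℝ) ≤ Z.card)]
      have hkNr : (k : ℝ) ≤ Zᶜ.card := by exact_mod_cast hkN
      generalize (Zᶜ.card : ℝ) = N at *
      have hN0 : 0 < N := by linarith
      -- A clean step moves `y` with probability `k / N ≥ k / n`, which gains one power. Under
      -- truncated subtraction only `m + 1 - b ≤ (m - b) + 1` is needed.
      have hpow : (1 - k / N) * (1 - k / n : ℝ) ^ (m - b) ≤ (1 - k / n : ℝ) ^ (m + 1 - b) := by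
        have h1 : 1 - k / N ≤ 1 - (k : ℝ) / n := by
          have := div_le_div_of_nonneg_left (by linarith : (0 : ℝ) ≤ k) hN0 hNn
          linarith
        have h2 : (0 : ℝ) ≤ (1 - k / n : ℝ) ^ (m - b) := by positivity
        refine (mul_le_mul_of_nonneg_right h1 h2).trans ?_
        rw [← pow_succ']
        exact pow_le_pow_of_le_one hρ0 hρ1 (by omega)
      have hρN : 0 ≤ 1 - k / N := by
        rw [sub_nonneg, div_le_one hN0]; exact hkNr
      -- The constant `1 / (n - Q - 1)` survives a clean step, since it dominates the probability `1
      -- / (N - 1)` with which a moved point lands at `z`.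
      have hfrac : (1 - k / N) * (1 / ((n : ℝ) - Q - 1)) + k / (N * (N - 1)) ≤
          1 / ((n : ℝ) - Q - 1) := by
        have h1 : k / (N * (N - 1)) ≤ k / N * (1 / ((n : ℝ) - Q - 1)) := by
          rw [div_mul_div_comm, mul_one]
          exact div_le_div_of_nonneg_left (by linarith) (mul_pos hN0 hM)
            (mul_le_mul_of_nonneg_left hNM hN0.le)
        linarith
      have hstep : (1 - k / N) * a z + k / (N * (N - 1)) * A ≤
          (1 / ((n : ℝ) - Q - 1) + (1 - k / n : ℝ) ^ (m + 1 - b)) * A := by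
        have h1 := mul_le_mul_of_nonneg_left (ih d b z) hρN
        have h2 := mul_le_mul_of_nonneg_right (add_le_add hfrac hpow) (hA0 d b)
        calc _ ≤ (1 - k / N) * ((1 / ((n : ℝ) - Q - 1) + (1 - k / n : ℝ) ^ (m - b)) * A) +
              k / (N * (N - 1)) * A := add_le_add h1 le_rfl
          _ = ((1 - k / N) * (1 / ((n : ℝ) - Q - 1)) + k / (N * (N - 1)) +
              (1 - k / N) * (1 - k / n : ℝ) ^ (m - b)) * A := by ring
          _ ≤ _ := h2
      calc _ ≤ fixProb u Z * ((1 / ((n : ℝ) - Q - 1) + (1 - k / n : ℝ) ^ (m + 1 - b)) * A) :=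
            mul_le_mul_of_nonneg_left hstep hF
        _ = _ := by ring
    · rw [Finset.mul_sum]
      refine Finset.sum_le_sum fun g _ => ?_
      by_cases hg : ∀ x ∈ Z, g x = x
      · rw [ind_of_false (not_not.mpr hg)]; simp
      rw [ind_of_true hg, one_mul, one_mul, mul_left_comm]
      refine mul_le_mul_of_nonneg_left ?_ (hu.nonneg g)
      -- Nothing is known about the effect of this step on `y`, but it lowers `b` by at least one,
      -- and this compensates for the lost step in the exponent.
      have hc : 1 ≤ movedCount Y d g := by
        rw [Nat.one_le_iff_ne_zero, ne_eq, movedCount_eq_zero_iff]; exact hg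
      by_cases hcb : movedCount Y d g ≤ b
      · have hrev : ∀ w, Reveals Y d b (g :: w) ↔
            Reveals Y (fun x => g⁻¹ (d x)) (b - movedCount Y d g) w := fun w => by
          rw [reveals_cons_iff]; exact and_iff_right hcb
        simp only [hrev, hclose]
        refine (ih _ _ _).trans (mul_le_mul_of_nonneg_right ?_ (hA0 _ _))
        have : (1 - k / n : ℝ) ^ (m - (b - movedCount Y d g)) ≤ (1 - k / n : ℝ) ^ (m + 1 - b) :=
          pow_le_pow_of_le_one hρ0 hρ1 (by omega)
        linarith
      · have hrev : ∀ w, ¬ Reveals Y d b (g :: w) := fun w => by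
          rw [reveals_cons_iff]; exact fun h => hcb h.1
        simp only [hrev, false_and, ind_of_false not_false, avg_zero, mul_zero, le_refl]

/-! ### Exploring cycles image by image: the factorial moment bound -/

/-- The permutation `σ * w.prod` maps the points of `Y` as prescribed by `d`. -/
def Extends (σ : Equiv.Perm (Fin n)) (Y : Finset (Fin n)) (d : Fin n → Fin n)
    (w : List (Equiv.Perm (Fin n))) : Prop :=
  ∀ x ∈ Y, (σ * w.prod) x = d x

/-- `Extends`, with at most `B` moves of the trajectories of the points of `Y`. -/
def ExtendsLE (σ : Equiv.Perm (Fin n)) (B : ℕ) (Y : Finset (Fin n)) (d : Fin n → Fin n)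
    (w : List (Equiv.Perm (Fin n))) : Prop :=
  Extends σ Y d w ∧ ∑ x ∈ Y, touches w x ≤ B

lemma extends_insert_iff {σ : Equiv.Perm (Fin n)} {Y : Finset (Fin n)} {d : Fin n → Fin n}
    {w : List (Equiv.Perm (Fin n))} {c v : Fin n} (hc : c ∉ Y) :
    Extends σ (insert c Y) (Function.update d c v) w ↔
      Extends σ Y d w ∧ (σ * w.prod) c = v := by
  unfold Extends
  rw [Finset.forall_mem_insert, Function.update_self, and_comm]
  refine and_congr_left fun _ => forall₂_congr fun x hx => ?_
  rw [Function.update_of_ne (ne_of_mem_of_not_mem hx hc)]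

lemma ExtendsLE.of_insert {σ : Equiv.Perm (Fin n)} {B : ℕ} {Y : Finset (Fin n)}
    {d : Fin n → Fin n} {w : List (Equiv.Perm (Fin n))} {c v : Fin n} (hc : c ∉ Y)
    (h : ExtendsLE σ B (insert c Y) (Function.update d c v) w) :
    ExtendsLE σ B Y d w ∧ (σ * w.prod) c = v := by
  have h1 := (extends_insert_iff hc).mp h.1
  refine ⟨⟨h1.1, ?_⟩, h1.2⟩
  have := h.2
  rw [Finset.sum_insert hc] at this
  omega

/-- The event splits according to the exact number `b ≤ B` of moves, and `m - B ≤ m - b` makes the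
bound uniform in `b`. The initial permutation is absorbed into the targets through `σ⁻¹`. -/
theorem StepLaw.avg_extendsLE_and_le {k : ℕ} {u : Equiv.Perm (Fin n) → ℝ} (hu : StepLaw k u)
    (hk : 2 ≤ k) {Q : ℕ} (hQ : Q + k ≤ n) {Y : Finset (Fin n)} (hY : Y.card ≤ Q) {y : Fin n}
    (hy : y ∉ Y) (m : ℕ) (σ : Equiv.Perm (Fin n)) (d : Fin n → Fin n) (B : ℕ) (z : Fin n) :
    avg u m (fun w => ind (ExtendsLE σ B Y d w ∧ (σ * w.prod) y = z)) ≤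
      (1 / ((n : ℝ) - Q - 1) + (1 - k / n : ℝ) ^ (m - B)) *
        avg u m (fun w => ind (ExtendsLE σ B Y d w)) := by
  have hmul : ∀ (w : List (Equiv.Perm (Fin n))) (x v : Fin n),
      (σ * w.prod) x = v ↔ w.prod x = σ⁻¹ v := fun w x v => by
    rw [Equiv.Perm.mul_apply, Equiv.Perm.eq_inv_iff_eq]
  have hsum : ∀ w, ind (ExtendsLE σ B Y d w) =
      ∑ b ∈ Finset.range (B + 1), ind (Reveals Y (fun x => σ⁻¹ (d x)) b w) := by
    intro w
    by_cases h : ExtendsLE σ B Y d w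
    · rw [ind_of_true h, Finset.sum_eq_single (∑ x ∈ Y, touches w x)]
      · exact (ind_of_true ⟨fun x hx => (hmul w x (d x)).mp (h.1 x hx), rfl⟩).symm
      · intro b _ hb
        exact ind_of_false fun h' => hb h'.2.symm
      · intro hb
        exact (hb (Finset.mem_range.mpr (Nat.lt_succ_of_le h.2))).elim
    · rw [ind_of_false h, Finset.sum_eq_zero]
      intro b hb
      refine ind_of_false fun h' => h ⟨fun x hx => (hmul w x (d x)).mpr (h'.1 x hx), ?_⟩
      rw [h'.2]
      exact Nat.lt_succ_iff.mp (Finset.mem_range.mp hb)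
  have hsum' : ∀ w, ind (ExtendsLE σ B Y d w ∧ (σ * w.prod) y = z) =
      ∑ b ∈ Finset.range (B + 1),
        ind (Reveals Y (fun x => σ⁻¹ (d x)) b w ∧ w.prod y = σ⁻¹ z) := by
    intro w
    rw [ind_and, hsum, Finset.sum_mul]
    refine Finset.sum_congr rfl fun b _ => ?_
    rw [ind_and, ind_congr (hmul w y z)]
  simp only [hsum, hsum']
  rw [avg_sum, avg_sum, Finset.mul_sum]
  refine Finset.sum_le_sum fun b hb => ?_
  refine (hu.avg_reveals_and_le hk hQ hY hy m _ b _).trans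
    (mul_le_mul_of_nonneg_right ?_ (hu.avg_nonneg m fun w => ind_nonneg _))
  have hb' : b ≤ B := Nat.lt_succ_iff.mp (Finset.mem_range.mp hb)
  have hkn : (k : ℝ) ≤ n := by exact_mod_cast (by omega : k ≤ n)
  have hn : (0 : ℝ) < n := by exact_mod_cast (by omega : 0 < n)
  have h0 : 0 ≤ 1 - (k : ℝ) / n := by
    rw [sub_nonneg, div_le_one hn]; exact hkn
  have h1 : 1 - (k : ℝ) / n ≤ 1 := by
    have : 0 ≤ (k : ℝ) / n := by positivity
    linarith
  have := pow_le_pow_of_le_one h0 h1 (by omega : m - B ≤ m - b)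
  linarith

/-- Follow a permutation `π` from `c` for `a` steps through new points only, adding them to the set
of known points; the path has to end at `x`, where the set of known points is evaluated by `F`. -/
noncomputable def explore (F : Finset (Fin n) → ℝ) (π : Equiv.Perm (Fin n)) (x : Fin n) :
    ℕ → Finset (Fin n) → Fin n → ℝ
  | 0, Y, c => ind (c = x) * F Y
  | a + 1, Y, c => ind (c ∉ Y) * explore F π x a (insert c Y) (π c)

/-- A weighted count of the sequences of `r` distinct cycles of `π` with sizes in `S`, each with a
marked point, that avoid `Y`. -/
noncomputable def cycleSeqs (S : Finset ℕ) (π : Equiv.Perm (Fin n)) : ℕ → Finset (Fin n) → ℝ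
  | 0, _ => 1
  | r + 1, Y => ∑ s ∈ S, ∑ x, explore (cycleSeqs S π r) π x s Y x

lemma explore_nonneg {F : Finset (Fin n) → ℝ} (hF : ∀ Y, 0 ≤ F Y) (π : Equiv.Perm (Fin n))
    (x : Fin n) (a : ℕ) (Y : Finset (Fin n)) (c : Fin n) : 0 ≤ explore F π x a Y c := by
  induction a generalizing Y c with
  | zero => exact mul_nonneg (ind_nonneg _) (hF Y)
  | succ a ih => exact mul_nonneg (ind_nonneg _) (ih _ _)

lemma cycleSeqs_nonneg (S : Finset ℕ) (π : Equiv.Perm (Fin n)) (r : ℕ) (Y : Finset (Fin n)) :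
    0 ≤ cycleSeqs S π r Y := by
  induction r generalizing Y with
  | zero => exact zero_le_one
  | succ r ih =>
    exact Finset.sum_nonneg fun s _ => Finset.sum_nonneg fun x _ => explore_nonneg ih π x s Y x

/-- No trajectory is moved more than `t` times. -/
def FewTouches (t : ℕ) (w : List (Equiv.Perm (Fin n))) : Prop := ∀ x, touches w x ≤ t

/-- Given the images of at most `q` points, the conditional expectation of `F` on `FewTouches` is at
most `κ`. -/
def CondBound (u : Equiv.Perm (Fin n) → ℝ) (m : ℕ) (σ : Equiv.Perm (Fin n)) (B t : ℕ)
    (F : Equiv.Perm (Fin n) → Finset (Fin n) → ℝ) (κ : ℝ) (q : ℕ) : Prop :=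
  ∀ Y d, Y.card ≤ q →
    avg u m (fun w => ind (Extends σ Y d w) * (ind (FewTouches t w) * F (σ * w.prod) Y)) ≤
      κ * avg u m (fun w => ind (ExtendsLE σ B Y d w))

/-- Only the closing image, which must be `x`, is charged a factor `ε`; the intermediate images
range over disjoint events. Inside the average `FewTouches` is kept, while the right-hand side only
needs the budget `B` for the revealed points, an event determined by their trajectories. -/
lemma StepLaw.avg_explore_le {k : ℕ} {u : Equiv.Perm (Fin n) → ℝ} (hu : StepLaw k u)
    (hk : 2 ≤ k) {Q : ℕ} (hQ : Q + k ≤ n) {m : ℕ} {σ : Equiv.Perm (Fin n)} {B t : ℕ}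
    {F : Equiv.Perm (Fin n) → Finset (Fin n) → ℝ} {κ : ℝ} (hκ : 0 ≤ κ) {q : ℕ} (hq : q ≤ Q)
    (hF : CondBound u m σ B t F κ q) (x : Fin n) (a : ℕ) (Y : Finset (Fin n))
    (d : Fin n → Fin n) (c : Fin n) (hY : Y.card + (a + 1) ≤ q) :
    avg u m (fun w => ind (Extends σ Y d w) * (ind (FewTouches t w) *
      explore (F (σ * w.prod)) (σ * w.prod) x (a + 1) Y c)) ≤
      (1 / ((n : ℝ) - Q - 1) + (1 - k / n : ℝ) ^ (m - B)) * κ *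
        avg u m (fun w => ind (ExtendsLE σ B Y d w)) := by
  have hkn : (k : ℝ) ≤ n := by exact_mod_cast (by omega : k ≤ n)
  have hn : (0 : ℝ) < n := by exact_mod_cast (by omega : 0 < n)
  have h0 : 0 ≤ 1 - (k : ℝ) / n := by
    rw [sub_nonneg, div_le_one hn]; exact hkn
  have hM : 0 < (n : ℝ) - Q - 1 := by
    have : (Q : ℝ) + k ≤ n := by exact_mod_cast hQ
    have : (2 : ℝ) ≤ k := by exact_mod_cast hk
    linarith
  set ε := 1 / ((n : ℝ) - Q - 1) + (1 - k / n : ℝ) ^ (m - B) with hε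
  have hε0 : 0 ≤ ε := by positivity
  have hnn : ∀ Y d, 0 ≤ avg u m (fun w => ind (ExtendsLE σ B Y d w)) :=
    fun Y d => hu.avg_nonneg m fun w => ind_nonneg _
  induction a generalizing Y d c with
  | zero =>
    by_cases hc : c ∈ Y
    · have : ∀ w : List (Equiv.Perm (Fin n)), ind (Extends σ Y d w) * (ind (FewTouches t w) *
          explore (F (σ * w.prod)) (σ * w.prod) x (0 + 1) Y c) = 0 := fun w => by
        rw [explore, ind_of_false (not_not.mpr hc)]; ring
      simp only [this, avg_zero]
      exact mul_nonneg (mul_nonneg hε0 hκ) (hnn Y d)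
    have h1 : ∀ w : List (Equiv.Perm (Fin n)), ind (Extends σ Y d w) * (ind (FewTouches t w) *
        explore (F (σ * w.prod)) (σ * w.prod) x (0 + 1) Y c) =
        ind (Extends σ (insert c Y) (Function.update d c x) w) * (ind (FewTouches t w) *
          F (σ * w.prod) (insert c Y)) := fun w => by
      rw [explore, explore, ind_of_true hc, ind_congr (extends_insert_iff hc), ind_and]; ring
    simp only [h1]
    have hcard : (insert c Y).card ≤ q := by
      rw [Finset.card_insert_of_notMem hc]; omega
    refine (hF _ _ hcard).trans ?_
    have h2 : avg u m (fun w => ind (ExtendsLE σ B (insert c Y) (Function.update d c x) w)) ≤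
        ε * avg u m (fun w => ind (ExtendsLE σ B Y d w)) :=
      (hu.avg_mono m fun w => ind_mono fun h => ExtendsLE.of_insert hc h).trans
        (hu.avg_extendsLE_and_le hk hQ (by omega) hc m σ d B x)
    calc _ ≤ κ * (ε * avg u m (fun w => ind (ExtendsLE σ B Y d w))) :=
          mul_le_mul_of_nonneg_left h2 hκ
      _ = _ := by ring
  | succ a ih =>
    by_cases hc : c ∈ Y
    · have : ∀ w : List (Equiv.Perm (Fin n)), ind (Extends σ Y d w) * (ind (FewTouches t w) *
          explore (F (σ * w.prod)) (σ * w.prod) x (a + 1 + 1) Y c) = 0 := fun w => by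
        rw [explore, ind_of_false (not_not.mpr hc)]; ring
      simp only [this, avg_zero]
      exact mul_nonneg (mul_nonneg hε0 hκ) (hnn Y d)
    have h1 : ∀ w : List (Equiv.Perm (Fin n)), ind (Extends σ Y d w) * (ind (FewTouches t w) *
        explore (F (σ * w.prod)) (σ * w.prod) x (a + 1 + 1) Y c) =
        ∑ v, ind (Extends σ (insert c Y) (Function.update d c v) w) * (ind (FewTouches t w) *
          explore (F (σ * w.prod)) (σ * w.prod) x (a + 1) (insert c Y) v) := fun w => by
      rw [explore, ind_of_true hc, Finset.sum_eq_single ((σ * w.prod) c)]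
      · rw [ind_congr (extends_insert_iff hc), ind_and, ind_of_true rfl]; ring
      · intro v _ hv
        rw [ind_of_false, zero_mul]
        rw [extends_insert_iff hc]
        exact fun h => hv h.2.symm
      · simp
    simp only [h1]
    rw [avg_sum]
    have hcard : (insert c Y).card + (a + 1) ≤ q := by
      rw [Finset.card_insert_of_notMem hc]; omega
    refine (Finset.sum_le_sum fun v _ => ih (insert c Y) (Function.update d c v) v hcard).trans ?_
    rw [← Finset.mul_sum, ← avg_sum]
    refine mul_le_mul_of_nonneg_left (hu.avg_mono m fun w => ?_) (mul_nonneg hε0 hκ)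
    -- Dropping the moves of `c` only weakens the budget condition, and exactly one `v` is the image
    -- of `c`.
    calc _ ≤ ∑ v, ind (ExtendsLE σ B Y d w) * ind ((σ * w.prod) c = v) := by
          refine Finset.sum_le_sum fun v _ => ?_
          rw [← ind_and]
          exact ind_mono fun h => ExtendsLE.of_insert hc h
      _ = _ := by rw [← Finset.mul_sum, sum_ind_eq, mul_one]

/-- The factorial moment bound for the cycles with sizes in `S`. -/
theorem StepLaw.avg_cycleSeqs_le {k : ℕ} {u : Equiv.Perm (Fin n) → ℝ} (hu : StepLaw k u)
    (hk : 2 ≤ k) {Q : ℕ} (hQ : Q + k ≤ n) {m : ℕ} {σ : Equiv.Perm (Fin n)} {B t h : ℕ}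
    (hB : Q * t ≤ B) {S : Finset ℕ} (hS : ∀ s ∈ S, 1 ≤ s ∧ s ≤ h) (r : ℕ) :
    ∀ q, q + r * h ≤ Q → CondBound u m σ B t (fun π => cycleSeqs S π r)
      ((n * S.card * (1 / ((n : ℝ) - Q - 1) + (1 - k / n : ℝ) ^ (m - B))) ^ r) q := by
  have hkn : (k : ℝ) ≤ n := by exact_mod_cast (by omega : k ≤ n)
  have hn : (0 : ℝ) < n := by exact_mod_cast (by omega : 0 < n)
  have h0 : 0 ≤ 1 - (k : ℝ) / n := by
    rw [sub_nonneg, div_le_one hn]; exact hkn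
  have hM : 0 < (n : ℝ) - Q - 1 := by
    have : (Q : ℝ) + k ≤ n := by exact_mod_cast hQ
    have : (2 : ℝ) ≤ k := by exact_mod_cast hk
    linarith
  induction r with
  | zero =>
    intro q hq Y d hY
    rw [pow_zero, one_mul]
    refine hu.avg_mono m fun w => ?_
    simp only [cycleSeqs, mul_one]
    rw [← ind_and]
    -- On `FewTouches` at most `Q` revealed points are moved at most `t` times each; this is where
    -- `B` comes from.
    refine ind_mono fun h => ⟨h.1, ?_⟩
    calc ∑ x ∈ Y, touches w x ≤ ∑ _x ∈ Y, t := Finset.sum_le_sum fun x _ => h.2 x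
      _ = Y.card * t := by simp
      _ ≤ Q * t := Nat.mul_le_mul_right t (by omega)
      _ ≤ B := hB
  | succ r ih =>
    intro q hq Y d hY
    rw [Nat.add_mul, one_mul] at hq
    have hF := ih (q + h) (by omega)
    set ε := 1 / ((n : ℝ) - Q - 1) + (1 - k / n : ℝ) ^ (m - B) with hε
    have hε0 : 0 ≤ ε := by positivity
    have hκ : 0 ≤ (n * S.card * ε) ^ r := by positivity
    simp only [cycleSeqs, Finset.mul_sum]
    rw [avg_sum]
    -- One more cycle: `S.card` sizes and `n` marked points, each at the price `ε`. The cycle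
    -- reveals at most `h` points, hence the induction hypothesis at `q + h`.
    calc ∑ s ∈ S, avg u m (fun w => ∑ x, ind (Extends σ Y d w) * (ind (FewTouches t w) *
            explore (cycleSeqs S (σ * w.prod) r) (σ * w.prod) x s Y x))
        ≤ ∑ _s ∈ S, ∑ _x : Fin n, ε * (n * S.card * ε) ^ r *
            avg u m (fun w => ind (ExtendsLE σ B Y d w)) := by
          refine Finset.sum_le_sum fun s hs => ?_
          rw [avg_sum]
          refine Finset.sum_le_sum fun x _ => ?_
          obtain ⟨a, rfl⟩ : ∃ a, s = a + 1 := ⟨s - 1, by have := (hS s hs).1; omega⟩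
          exact hu.avg_explore_le hk hQ hκ (by omega) hF x a Y d x
            (by have := (hS _ hs).2; omega)
      _ = _ := by
          simp only [Finset.sum_const, Finset.card_univ, Fintype.card_fin, nsmul_eq_mul]
          ring

/-! ### From cycle counts to sequences of cycles -/

lemma iterate_notMem {π : Equiv.Perm (Fin n)} {Y : Finset (Fin n)}
    (hY : ∀ y, π y ∈ Y ↔ y ∈ Y) {x : Fin n} (hx : x ∉ Y) (i : ℕ) : π^[i] x ∉ Y := by
  induction i with
  | zero => exact hx
  | succ i ih => rwa [Function.iterate_succ_apply', hY]

/-- The first `s` points of the orbit of `x`. -/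
def orbitFinset (π : Equiv.Perm (Fin n)) (x : Fin n) (s : ℕ) : Finset (Fin n) :=
  (Finset.range s).image fun i => π^[i] x

/-- Following `x` for exactly its period meets only new points, since `Y` is a union of cycles
avoiding `x`, and then returns; so no indicator vanishes. The induction runs over the number `a` of
remaining steps. -/
lemma explore_orbit {π : Equiv.Perm (Fin n)} {Y : Finset (Fin n)}
    (hY : ∀ y, π y ∈ Y ↔ y ∈ Y) {x : Fin n} (hx : x ∉ Y) (F : Finset (Fin n) → ℝ) :
    explore F π x (Function.minimalPeriod π x) Y x =
      F (Y ∪ orbitFinset π x (Function.minimalPeriod π x)) := by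
  set s := Function.minimalPeriod π x with hs
  have key : ∀ a ≤ s, explore F π x a (Y ∪ orbitFinset π x (s - a)) (π^[s - a] x) =
      F (Y ∪ orbitFinset π x s) := by
    intro a
    induction a with
    | zero =>
      intro _
      rw [Nat.sub_zero, explore, hs, Function.iterate_minimalPeriod, ind_of_true rfl, one_mul]
    | succ a ih =>
      intro ha
      have hnot : π^[s - (a + 1)] x ∉ Y ∪ orbitFinset π x (s - (a + 1)) := by
        rw [Finset.mem_union, not_or]
        refine ⟨iterate_notMem hY hx _, fun h => ?_⟩
        obtain ⟨i, hi, hie⟩ := Finset.mem_image.mp h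
        rw [Finset.mem_range] at hi
        have := Function.iterate_injOn_Iio_minimalPeriod (f := π) (x := x)
          (Set.mem_Iio.mpr (by omega)) (Set.mem_Iio.mpr (by omega)) hie
        omega
      have hins : insert (π^[s - (a + 1)] x) (Y ∪ orbitFinset π x (s - (a + 1))) =
          Y ∪ orbitFinset π x (s - a) := by
        rw [show s - a = s - (a + 1) + 1 by omega]
        unfold orbitFinset
        rw [Finset.range_add_one, Finset.image_insert, Finset.union_insert]
      rw [explore, ind_of_true hnot, one_mul, hins, ← Function.iterate_succ_apply' (f := π),
        show (s - (a + 1)).succ = s - a by omega]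
      exact ih (by omega)
  have := key s le_rfl
  rw [Nat.sub_self] at this
  simpa [orbitFinset] using this

lemma mem_union_orbitFinset_iff {π : Equiv.Perm (Fin n)} {Y : Finset (Fin n)}
    (hY : ∀ y, π y ∈ Y ↔ y ∈ Y) {x : Fin n} (y : Fin n) :
    π y ∈ Y ∪ orbitFinset π x (Function.minimalPeriod π x) ↔
      y ∈ Y ∪ orbitFinset π x (Function.minimalPeriod π x) := by
  rw [Finset.mem_union, Finset.mem_union, hY]
  refine or_congr_right ?_
  simp only [orbitFinset, Finset.mem_image, Finset.mem_range]
  constructor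
  · rintro ⟨i, hi, h⟩
    rcases i with _ | i
    · refine ⟨Function.minimalPeriod π x - 1, by omega, π.injective ?_⟩
      rw [← h, ← Function.iterate_succ_apply' (f := π),
        show (Function.minimalPeriod π x - 1).succ = Function.minimalPeriod π x by omega,
        Function.iterate_minimalPeriod, Function.iterate_zero_apply]
    · refine ⟨i, by omega, π.injective ?_⟩
      rw [← h, Function.iterate_succ_apply']
  · rintro ⟨i, hi, rfl⟩
    rw [← Function.iterate_succ_apply' (f := π)]
    rcases Nat.lt_or_ge (i + 1) (Function.minimalPeriod π x) with h | h
    · exact ⟨i + 1, h, rfl⟩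
    · refine ⟨0, by omega, ?_⟩
      rw [show i.succ = Function.minimalPeriod π x by omega, Function.iterate_minimalPeriod,
        Function.iterate_zero_apply]

/-- A permutation with many points in cycles with sizes in `S` has many sequences of `r` distinct
such cycles. -/
lemma pow_le_cycleSeqs {π : Equiv.Perm (Fin n)} {S : Finset ℕ} {h : ℕ} (hS : ∀ s ∈ S, s ≤ h)
    (L r : ℕ) (Y : Finset (Fin n)) (hY : ∀ y, π y ∈ Y ↔ y ∈ Y)
    (hL : L + Y.card + r * h ≤
      (Finset.univ.filter fun x => Function.minimalPeriod π x ∈ S).card) :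
    (L : ℝ) ^ r ≤ cycleSeqs S π r Y := by
  induction r generalizing Y with
  | zero => simp [cycleSeqs]
  | succ r ih =>
    set V := Finset.univ.filter fun x => Function.minimalPeriod π x ∈ S with hV
    have hnn : ∀ s x, 0 ≤ explore (cycleSeqs S π r) π x s Y x :=
      fun s x => explore_nonneg (cycleSeqs_nonneg S π r) π x s Y x
    -- Discarding the cycle of `x` costs at most `h` points, which the reserve `r * h` in the
    -- hypothesis pays for; the enlarged set is again invariant.
    have hterm : ∀ x ∈ V \ Y, (L : ℝ) ^ r ≤ ∑ s ∈ S, explore (cycleSeqs S π r) π x s Y x := by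
      intro x hx
      rw [Finset.mem_sdiff, hV, Finset.mem_filter] at hx
      have hxS := hx.1.2
      refine le_trans ?_ (Finset.single_le_sum (fun s _ => hnn s x) hxS)
      rw [explore_orbit hY hx.2]
      refine ih _ (fun y => mem_union_orbitFinset_iff hY y) ?_
      have h1 := Finset.card_union_le Y (orbitFinset π x (Function.minimalPeriod π x))
      have h2 : (orbitFinset π x (Function.minimalPeriod π x)).card ≤ h :=
        Finset.card_image_le.trans ((Finset.card_range _).trans_le (hS _ hxS))
      rw [Nat.add_mul, one_mul] at hL
      omega
    have hcard : L ≤ (V \ Y).card := by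
      have := Finset.le_card_sdiff Y V
      omega
    calc (L : ℝ) ^ (r + 1) = L * (L : ℝ) ^ r := pow_succ' _ _
      _ ≤ (V \ Y).card * (L : ℝ) ^ r := by gcongr
      _ = ∑ _x ∈ V \ Y, (L : ℝ) ^ r := by simp
      _ ≤ ∑ x ∈ V \ Y, ∑ s ∈ S, explore (cycleSeqs S π r) π x s Y x := Finset.sum_le_sum hterm
      _ ≤ ∑ x, ∑ s ∈ S, explore (cycleSeqs S π r) π x s Y x :=
          Finset.sum_le_sum_of_subset_of_nonneg (Finset.subset_univ _) fun x _ _ =>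
            Finset.sum_nonneg fun s _ => hnn s x
      _ = cycleSeqs S π (r + 1) Y := by rw [cycleSeqs, Finset.sum_comm]

lemma minimalPeriod_of_mem_support {π c : Equiv.Perm (Fin n)} (hc : c ∈ π.cycleFactorsFinset)
    {x : Fin n} (hx : x ∈ c.support) : Function.minimalPeriod π x = c.support.card := by
  have hco : c = π.cycleOf x := Equiv.Perm.cycle_is_cycleOf hx hc
  have hon : π.IsCycleOn c.support := by
    rw [hco]; exact Equiv.Perm.isCycleOn_support_cycleOf π x
  refine Nat.dvd_antisymm ?_ ?_
  · refine Function.IsPeriodicPt.minimalPeriod_dvd ?_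
    rw [Function.IsPeriodicPt, Function.IsFixedPt, Equiv.Perm.iterate_eq_pow]
    exact (hon.pow_apply_eq hx).mpr dvd_rfl
  · refine (hon.pow_apply_eq hx).mp ?_
    rw [← Equiv.Perm.iterate_eq_pow]
    exact Function.iterate_minimalPeriod

/-- Cycles of size `i` have disjoint supports of `i` points of period `i`. Size `1` is separate,
because `cycleType` omits fixed points and `partition` adds them. -/
lemma mul_cycleCount_le (π : Equiv.Perm (Fin n)) {i : ℕ} (hi : 1 ≤ i) :
    i * cycleCount π i ≤
      (Finset.univ.filter fun x => Function.minimalPeriod π x = i).card := by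
  rw [cycleCount, Equiv.Perm.parts_partition, Multiset.count_add]
  rcases Nat.eq_or_lt_of_le hi with rfl | hi
  · have h0 : Multiset.count 1 π.cycleType = 0 := by
      rw [Multiset.count_eq_zero]
      intro h
      exact absurd (Equiv.Perm.one_lt_of_mem_cycleType h) (lt_irrefl 1)
    rw [h0, Multiset.count_replicate_self, one_mul, zero_add, ← Finset.card_compl]
    refine Finset.card_le_card fun x hx => ?_
    rw [Finset.mem_compl, Equiv.Perm.notMem_support] at hx
    rw [Finset.mem_filter]
    exact ⟨Finset.mem_univ x, Function.minimalPeriod_eq_one_iff_isFixedPt.mpr hx⟩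
  · have h0 : Multiset.count i (Multiset.replicate (Fintype.card (Fin n) - π.support.card) 1) = 0 := by
      rw [Multiset.count_replicate, if_neg (by omega)]
    rw [h0, add_zero, Equiv.Perm.cycleType_def, Multiset.count_map]
    change i * (π.cycleFactorsFinset.filter fun c => i = c.support.card).card ≤ _
    set T := π.cycleFactorsFinset.filter fun c => i = c.support.card with hT
    have hdisj : (T : Set (Equiv.Perm (Fin n))).PairwiseDisjoint Equiv.Perm.support := by
      intro c hc c' hc' hne
      refine Equiv.Perm.Disjoint.disjoint_support
        (Equiv.Perm.cycleFactorsFinset_pairwise_disjoint π ?_ ?_ hne)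
      · exact (Finset.mem_filter.mp hc).1
      · exact (Finset.mem_filter.mp hc').1
    have hcard : (T.biUnion Equiv.Perm.support).card = i * T.card := by
      rw [Finset.card_biUnion hdisj, Finset.sum_congr rfl fun c hc =>
        (Finset.mem_filter.mp hc).2.symm, Finset.sum_const, smul_eq_mul, mul_comm]
    rw [← hcard]
    refine Finset.card_le_card fun x hx => ?_
    obtain ⟨c, hc, hxc⟩ := Finset.mem_biUnion.mp hx
    rw [Finset.mem_filter] at hc ⊢
    exact ⟨Finset.mem_univ x, (minimalPeriod_of_mem_support hc.1 hxc).trans hc.2.symm⟩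

lemma two_pow_mul_stripCount_le (π : Equiv.Perm (Fin n)) (j : ℕ) :
    2 ^ j * stripCount π j ≤ (Finset.univ.filter fun x =>
      Function.minimalPeriod π x ∈ Finset.Ico (2 ^ j) (2 ^ (j + 1))).card := by
  have hfib := Finset.card_eq_sum_card_fiberwise
    (s := Finset.univ.filter fun x =>
      Function.minimalPeriod π x ∈ Finset.Ico (2 ^ j) (2 ^ (j + 1)))
    (f := fun x => Function.minimalPeriod π x)
    (t := Finset.Ico (2 ^ j) (2 ^ (j + 1))) fun x hx => (Finset.mem_filter.mp hx).2
  rw [hfib, stripCount, Finset.mul_sum]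
  refine Finset.sum_le_sum fun i hi => ?_
  have hi' := Finset.mem_Ico.mp hi
  refine (Nat.mul_le_mul_right _ hi'.1).trans ((mul_cycleCount_le π
    (Nat.one_le_two_pow.trans hi'.1)).trans (Finset.card_le_card fun x hx => ?_))
  rw [Finset.mem_filter] at hx ⊢
  rw [Finset.mem_filter]
  refine ⟨⟨Finset.mem_univ x, ?_⟩, hx.2⟩
  rw [hx.2]
  exact hi

/-! ### The tail bound for one strip -/

variable {k : ℕ} {u : Equiv.Perm (Fin n) → ℝ}

/-- Markov's inequality for the sum over all points of `2 ^ touches`. -/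
lemma StepLaw.avg_not_fewTouches_le (hu : StepLaw k u) (m t : ℕ) :
    avg u m (fun w => ind (¬ FewTouches t w)) ≤ n * (1 + k / n : ℝ) ^ m / 2 ^ t := by
  have hpt : ∀ w : List (Equiv.Perm (Fin n)),
      ind (¬ FewTouches t w) ≤ ∑ x, (1 / 2 ^ t : ℝ) * 2 ^ touches w x := by
    intro w
    have hnn : ∀ x ∈ (Finset.univ : Finset (Fin n)), (0 : ℝ) ≤ (1 / 2 ^ t : ℝ) * 2 ^ touches w x :=
      fun x _ => by positivity
    by_cases h : FewTouches t w
    · rw [ind_of_false (not_not.mpr h)]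
      exact Finset.sum_nonneg hnn
    · rw [ind_of_true h]
      unfold FewTouches at h
      push Not at h
      obtain ⟨x, hx⟩ := h
      refine le_trans ?_ (Finset.single_le_sum hnn (Finset.mem_univ x))
      rw [div_mul_eq_mul_div, one_mul, le_div_iff₀ (by positivity), one_mul]
      exact pow_le_pow_right₀ one_le_two hx.le
  refine (hu.avg_mono m hpt).trans ?_
  rw [avg_sum]
  simp only [avg_const_mul, hu.avg_two_pow_touches]
  rw [Finset.sum_const, Finset.card_univ, Fintype.card_fin, nsmul_eq_mul]
  apply le_of_eq
  ring

/-- A tail bound for the number of cycles in a dyadic strip after `m` steps. -/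
theorem StepLaw.avg_stripCount_le (hu : StepLaw k u) (hk : 2 ≤ k) {j r L t : ℕ} (hL : 0 < L)
    (hQ : r * 2 ^ (j + 1) + k ≤ n) (m : ℕ) (σ : Equiv.Perm (Fin n)) :
    avg u m (fun w => ind (L + 2 * r ≤ stripCount (σ * w.prod) j)) ≤
      n * (1 + k / n : ℝ) ^ m / 2 ^ t +
      (n * (1 / ((n : ℝ) - (r * 2 ^ (j + 1) : ℕ) - 1) +
        (1 - k / n : ℝ) ^ (m - r * 2 ^ (j + 1) * t)) / L) ^ r := by
  set S := Finset.Ico (2 ^ j) (2 ^ (j + 1)) with hS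
  set ε := 1 / ((n : ℝ) - (r * 2 ^ (j + 1) : ℕ) - 1) +
        (1 - k / n : ℝ) ^ (m - r * 2 ^ (j + 1) * t) with hε
  have hSh : ∀ s ∈ S, 1 ≤ s ∧ s ≤ 2 ^ (j + 1) := fun s hs =>
    ⟨Nat.one_le_two_pow.trans (Finset.mem_Ico.mp hs).1, (Finset.mem_Ico.mp hs).2.le⟩
  have hScard : (S.card : ℝ) = 2 ^ j := by
    rw [hS, Nat.card_Ico, pow_succ]
    rw [show 2 ^ j * 2 - 2 ^ j = 2 ^ j by omega]
    push_cast
    rfl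
  have hfact := hu.avg_cycleSeqs_le hk hQ (m := m) (σ := σ) (t := t) le_rfl hSh r 0 (by omega)
    ∅ id (by simp)
  have hone : avg u m (fun w => ind (ExtendsLE σ (r * 2 ^ (j + 1) * t) ∅ id w)) ≤ 1 := by
    rw [← hu.avg_one m]
    exact hu.avg_mono m fun w => ind_le_one _
  have hκ : 0 ≤ (n * S.card * ε) ^ r := by
    have hkn : (k : ℝ) ≤ n := by exact_mod_cast (by omega : k ≤ n)
    have hn : (0 : ℝ) < n := by exact_mod_cast (by omega : 0 < n)
    have h0 : 0 ≤ 1 - (k : ℝ) / n := by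
      rw [sub_nonneg, div_le_one hn]; exact hkn
    have hM : 0 < (n : ℝ) - (r * 2 ^ (j + 1) : ℕ) - 1 := by
      have : ((r * 2 ^ (j + 1) : ℕ) : ℝ) + k ≤ n := by exact_mod_cast hQ
      have : (2 : ℝ) ≤ k := by exact_mod_cast hk
      linarith
    positivity
  have hbd := hfact.trans (mul_le_of_le_one_right hκ hone)
  have hLpos : (0 : ℝ) < ((2 ^ j * L : ℕ) : ℝ) ^ r := by positivity
  have hpt : ∀ w : List (Equiv.Perm (Fin n)),
      ind (L + 2 * r ≤ stripCount (σ * w.prod) j) ≤ ind (¬ FewTouches t w) +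
        (((2 ^ j * L : ℕ) : ℝ) ^ r)⁻¹ * (ind (Extends σ ∅ id w) * (ind (FewTouches t w) *
          cycleSeqs S (σ * w.prod) r ∅)) := by
    intro w
    have hnn : 0 ≤ (((2 ^ j * L : ℕ) : ℝ) ^ r)⁻¹ * (ind (Extends σ ∅ id w) *
        (ind (FewTouches t w) * cycleSeqs S (σ * w.prod) r ∅)) :=
      mul_nonneg (inv_nonneg.mpr hLpos.le) (mul_nonneg (ind_nonneg _)
        (mul_nonneg (ind_nonneg _) (cycleSeqs_nonneg _ _ _ _)))
    by_cases hs : L + 2 * r ≤ stripCount (σ * w.prod) j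
    swap
    · rw [ind_of_false hs]
      exact add_nonneg (ind_nonneg _) hnn
    by_cases hf : FewTouches t w
    swap
    · rw [ind_of_true hs, ind_of_true hf]
      linarith
    have hlow : (((2 ^ j * L : ℕ) : ℝ)) ^ r ≤ cycleSeqs S (σ * w.prod) r ∅ := by
      refine pow_le_cycleSeqs (fun s hs => (hSh s hs).2) _ _ _ (by simp) ?_
      refine le_trans ?_ (two_pow_mul_stripCount_le _ j)
      -- The cycles carry at least `2 ^ j * (L + 2 * r) = 2 ^ j * L + r * 2 ^ (j + 1)` points: the
      -- last term is the reserve for `r` removed cycles.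
      refine le_trans (le_of_eq ?_) (Nat.mul_le_mul_left _ hs)
      rw [Finset.card_empty, pow_succ]
      ring
    rw [ind_of_true hs, ind_of_false (not_not.mpr hf), ind_of_true hf,
      ind_of_true (p := Extends σ ∅ id w) (by simp [Extends]), zero_add, one_mul, one_mul,
      inv_mul_eq_div, le_div_iff₀ hLpos, one_mul]
    exact hlow
  have hadd : ∀ f f' : List (Equiv.Perm (Fin n)) → ℝ,
      avg u m (fun w => f w + f' w) = avg u m f + avg u m f' := by
    intro f f'
    have := avg_sum (u := u) (Finset.univ : Finset Bool) m fun b => if b then f else f'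
    simpa using this
  refine (hu.avg_mono m hpt).trans ?_
  rw [hadd, avg_const_mul]
  refine add_le_add (hu.avg_not_fewTouches_le m t) ?_
  rw [inv_mul_le_iff₀ hLpos]
  rw [← hε] at hbd
  refine hbd.trans (le_of_eq ?_)
  rw [hScard, ← mul_pow]
  have : (L : ℝ) ≠ 0 := by exact_mod_cast hL.ne'
  clear_value ε
  congr 1
  push_cast
  field_simp

/-! ### The steps of the walk as a product law -/

instance : DiscreteMeasurableSpace (Equiv.Perm (Fin n)) := ⟨fun _ => trivial⟩

/-- The probability vector of a uniformly chosen `k`-cycle. -/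
noncomputable def kCycleLaw (k n : ℕ) (g : Equiv.Perm (Fin n)) : ℝ :=
  (uniformOn (kCycles k n)).real {g}

lemma conj_mem_kCycles_iff (g h : Equiv.Perm (Fin n)) :
    h * g * h⁻¹ ∈ kCycles k n ↔ g ∈ kCycles k n := by
  have key : ∀ g h : Equiv.Perm (Fin n), g ∈ kCycles k n → h * g * h⁻¹ ∈ kCycles k n :=
    fun g h hg => ⟨hg.1.conj, by rw [Equiv.Perm.card_support_conj]; exact hg.2⟩
  refine ⟨fun hg => ?_, key g h⟩
  have := key _ h⁻¹ hg
  rwa [show h⁻¹ * (h * g * h⁻¹) * h⁻¹⁻¹ = g by group] at this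

lemma kCycleLaw_eq (g : Equiv.Perm (Fin n)) :
    kCycleLaw k n g = (Measure.count (kCycles k n)).toReal⁻¹ * ind (g ∈ kCycles k n) := by
  rw [kCycleLaw, uniformOn, measureReal_def, cond_apply (Set.toFinite _).measurableSet,
    ENNReal.toReal_mul, ENNReal.toReal_inv]
  congr 1
  by_cases hg : g ∈ kCycles k n
  · rw [Set.inter_eq_right.mpr (Set.singleton_subset_iff.mpr hg), ind_of_true hg,
      Measure.count_singleton, ENNReal.toReal_one]
  · rw [Set.inter_singleton_eq_empty.mpr hg, ind_of_false hg, measure_empty,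
      ENNReal.toReal_zero]

lemma stepLaw_kCycleLaw [IsProbabilityMeasure (uniformOn (kCycles k n))] :
    StepLaw k (kCycleLaw k n) where
  nonneg _ := measureReal_nonneg
  sum_eq_one := by
    unfold kCycleLaw
    rw [sum_measureReal_singleton]
    simp
  conj g h := by rw [kCycleLaw_eq, kCycleLaw_eq, ind_congr (conj_mem_kCycles_iff g h)]
  card_support g hg := by
    rw [kCycleLaw_eq] at hg
    by_contra h
    exact hg (by rw [ind_of_false (fun h' => h h'.2), mul_zero])

lemma avg_eq_sum (u : Equiv.Perm (Fin n) → ℝ) (m : ℕ) (f : List (Equiv.Perm (Fin n)) → ℝ) :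
    avg u m f = ∑ c : Fin m → Equiv.Perm (Fin n), (∏ i, u (c i)) * f (List.ofFn c) := by
  induction m generalizing f with
  | zero => simp [avg]
  | succ m ih =>
    rw [avg_succ, ← (Fin.consEquiv fun _ => Equiv.Perm (Fin n)).sum_comp, Fintype.sum_prod_type]
    refine Finset.sum_congr rfl fun g _ => ?_
    rw [ih, Finset.mul_sum]
    refine Finset.sum_congr rfl fun c _ => ?_
    simp [Fin.consEquiv, Fin.prod_univ_succ, List.ofFn_succ, mul_assoc]

/-- A bound on the averages over the steps that is uniform in the starting point bounds the
corresponding probability. -/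
theorem IsWalkData.measureReal_le {Ω : Type*} [MeasurableSpace Ω] {P : Measure Ω}
    [IsProbabilityMeasure P] {π₀ : Ω → Equiv.Perm (Fin n)} {γ : ℕ → Ω → Equiv.Perm (Fin n)}
    {N : ℝ≥0 → Ω → ℕ} (hW : IsWalkData P k n π₀ γ N) (m : ℕ)
    (p : Equiv.Perm (Fin n) → List (Equiv.Perm (Fin n)) → Prop) {C : ℝ}
    (hp : ∀ σ, avg (kCycleLaw k n) m (fun w => ind (p σ w)) ≤ C) :
    P.real {ω | p (π₀ ω) ((List.range m).map fun i => γ i ω)} ≤ C := by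
  classical
  set Y : Ω → Fin m → Equiv.Perm (Fin n) := fun ω i => γ i ω with hY
  have hYm : Measurable Y := measurable_pi_lambda _ fun i => hW.measurable_step i
  have hind : IndepFun π₀ Y P := hW.indep_init.comp (ψ := fun q : (ℕ → Equiv.Perm (Fin n)) ×
    (ℝ≥0 → ℕ) => fun i : Fin m => q.1 i) measurable_id
      (measurable_pi_lambda _ fun i => (measurable_pi_apply _).comp measurable_fst)
  have hindY : iIndepFun (fun (i : Fin m) ω => γ i ω) P :=
    hW.indep_steps.precomp Fin.val_injective
  have hmapY : P.map Y = Measure.pi fun i : Fin m => P.map (γ i) :=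
    (iIndepFun_iff_map_fun_eq_pi_map fun i : Fin m =>
      (hW.measurable_step i).aemeasurable).mp hindY
  have hprod := (indepFun_iff_map_prod_eq_prod_map_map hW.measurable_init.aemeasurable
    hYm.aemeasurable).mp hind
  have : IsProbabilityMeasure (P.map π₀) :=
    Measure.isProbabilityMeasure_map hW.measurable_init.aemeasurable
  have : ∀ i, IsProbabilityMeasure (P.map (γ i)) := fun i =>
    Measure.isProbabilityMeasure_map (hW.measurable_step i).aemeasurable
  have hXm : Measurable fun ω => (π₀ ω, Y ω) := hW.measurable_init.prodMk hYm
  set A : Set (Equiv.Perm (Fin n) × (Fin m → Equiv.Perm (Fin n))) :=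
    {q | p q.1 (List.ofFn q.2)} with hA
  have hset : {ω | p (π₀ ω) ((List.range m).map fun i => γ i ω)} =
      (fun ω => (π₀ ω, Y ω)) ⁻¹' A := by
    ext ω
    have : (List.range m).map (fun i => γ i ω) = List.ofFn (Y ω) := by
      rw [List.ofFn_eq_map, ← List.map_coe_finRange_eq_range, List.map_map]
      rfl
    simp only [Set.mem_ofPred_eq, hA, Set.mem_preimage, this]
  -- By independence the atoms of the joint law factor, so the probability is a mixture over the
  -- initial permutation of averages each bounded by `C`.
  have hsing : ∀ q : Equiv.Perm (Fin n) × (Fin m → Equiv.Perm (Fin n)),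
      (P.map fun ω => (π₀ ω, Y ω)).real {q} =
        (P.map π₀).real {q.1} * ∏ i, kCycleLaw k n (q.2 i) := by
    rintro ⟨σ, c⟩
    rw [hprod, hmapY, ← Set.singleton_prod_singleton, measureReal_prod_prod]
    congr 1
    rw [measureReal_def, Measure.pi_singleton, ENNReal.toReal_prod]
    refine Finset.prod_congr rfl fun i _ => ?_
    rw [hW.law_step i]
    rfl
  have hAsum : P.real ((fun ω => (π₀ ω, Y ω)) ⁻¹' A) =
      ∑ q, (P.map fun ω => (π₀ ω, Y ω)).real {q} * ind (q ∈ A) := by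
    have : IsProbabilityMeasure (P.map fun ω => (π₀ ω, Y ω)) :=
      Measure.isProbabilityMeasure_map hXm.aemeasurable
    rw [← map_measureReal_apply hXm (Set.toFinite A).measurableSet]
    have : A = ((Finset.univ.filter fun q => q ∈ A : Finset _) : Set _) := by simp
    conv_lhs => rw [this]
    rw [← sum_measureReal_singleton, Finset.sum_filter]
    refine Finset.sum_congr rfl fun q _ => ?_
    by_cases hq : q ∈ A <;> simp [hq, ind]
  rw [hset, hAsum, Fintype.sum_prod_type]
  calc ∑ σ, ∑ c, (P.map fun ω => (π₀ ω, Y ω)).real {(σ, c)} * ind ((σ, c) ∈ A)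
      = ∑ σ, (P.map π₀).real {σ} * avg (kCycleLaw k n) m (fun w => ind (p σ w)) := by
        refine Finset.sum_congr rfl fun σ _ => ?_
        rw [avg_eq_sum, Finset.mul_sum]
        refine Finset.sum_congr rfl fun c _ => ?_
        rw [hsing, mul_assoc]
        rfl
    _ ≤ ∑ σ, (P.map π₀).real {σ} * C :=
        Finset.sum_le_sum fun σ _ => mul_le_mul_of_nonneg_left (hp σ) measureReal_nonneg
    _ = C := by
        rw [← Finset.sum_mul, sum_measureReal_singleton]
        simp

lemma IsWalkData.isProbabilityMeasure_uniformOn {Ω : Type*} [MeasurableSpace Ω] {P : Measure Ω}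
    [IsProbabilityMeasure P] {π₀ : Ω → Equiv.Perm (Fin n)} {γ : ℕ → Ω → Equiv.Perm (Fin n)}
    {N : ℝ≥0 → Ω → ℕ} (hW : IsWalkData P k n π₀ γ N) :
    IsProbabilityMeasure (uniformOn (kCycles k n)) := by
  rw [← hW.law_step 0]
  exact Measure.isProbabilityMeasure_map (hW.measurable_step 0).aemeasurable

/-! ### Concentration of the Poisson clock -/

section Poisson

/-- The Poisson variance: the shift identity `(i + 1) p (i + 1) = r p i` yields the first two
moments. -/
lemma hasSum_poisson_mul_sq (r : ℝ≥0) :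
    HasSum (fun i : ℕ => Real.exp (-r) * r ^ i / (i.factorial : ℝ) * ((i : ℝ) - r) ^ 2) r := by
  set p : ℕ → ℝ := fun i => Real.exp (-r) * r ^ i / (i.factorial : ℝ) with hp
  have h0 : HasSum p 1 := hasSum_one_poissonMeasure r
  have hshift : ∀ i : ℕ, ((i : ℝ) + 1) * p (i + 1) = r * p i := by
    intro i
    simp only [hp, Nat.factorial_succ]
    push_cast
    have : ((i : ℝ) + 1) ≠ 0 := by positivity
    field_simp
    ring
  have h1 : HasSum (fun i : ℕ => (i : ℝ) * p i) r := by
    rw [← hasSum_nat_add_iff' 1]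
    simp only [Finset.sum_range_one, Nat.cast_zero, zero_mul, sub_zero]
    push_cast
    simp only [hshift]
    simpa using h0.mul_left (r : ℝ)
  have h2 : HasSum (fun i : ℕ => (i : ℝ) ^ 2 * p i) (r * (r + 1)) := by
    rw [← hasSum_nat_add_iff' 1]
    have : ∀ i : ℕ, ((i + 1 : ℕ) : ℝ) ^ 2 * p (i + 1) = r * (i * p i + p i) := by
      intro i
      push_cast
      rw [sq, mul_assoc, hshift]
      ring
    simp only [this, Finset.sum_range_one]
    simpa using (h1.add h0).mul_left (r : ℝ)
  convert! (h2.add (h1.mul_left (-2 * (r : ℝ)))).add (h0.mul_left ((r : ℝ) ^ 2)) using 1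
  · ext i
    ring
  · ring

/-- Chebyshev's inequality for the Poisson law. -/
lemma poissonMeasure_le_abs_sub (r : ℝ≥0) {c : ℝ} (hc : 0 < c) :
    poissonMeasure r {i : ℕ | c ≤ |(i : ℝ) - r|} ≤ ENNReal.ofReal (r / c ^ 2) := by
  have hint : ∫⁻ i, ENNReal.ofReal (((i : ℝ) - r) ^ 2) ∂(poissonMeasure r) = ENNReal.ofReal r := by
    conv_rhs => rw [← (hasSum_poisson_mul_sq r).tsum_eq]
    rw [poissonMeasure, lintegral_sum_measure,
      ENNReal.ofReal_tsum_of_nonneg (fun i => by positivity) (hasSum_poisson_mul_sq r).summable]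
    refine tsum_congr fun i => ?_
    rw [lintegral_smul_measure, lintegral_dirac, smul_eq_mul, ← ENNReal.ofReal_mul (by positivity)]
  have hsub : {i : ℕ | c ≤ |(i : ℝ) - r|} ⊆
      {i : ℕ | ENNReal.ofReal (c ^ 2) ≤ ENNReal.ofReal (((i : ℝ) - r) ^ 2)} := by
    intro i hi
    refine ENNReal.ofReal_le_ofReal ?_
    rw [← sq_abs ((i : ℝ) - r)]
    exact pow_le_pow_left₀ hc.le hi 2
  have hc2 : 0 < c ^ 2 := by positivity
  refine (measure_mono hsub).trans ((meas_ge_le_lintegral_div (by fun_prop) ?_ ?_).trans ?_)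
  · simpa using hc.ne'
  · exact ENNReal.ofReal_ne_top
  · rw [hint, ENNReal.ofReal_div_of_pos hc2]

lemma IsPoissonProcess.measure_le_abs_sub {Ω : Type*} [MeasurableSpace Ω] {P : Measure Ω}
    {N : ℝ≥0 → Ω → ℕ} (hN : IsPoissonProcess P N) (t : ℝ≥0) {c : ℝ} (hc : 0 < c) :
    P {ω | c ≤ |(N t ω : ℝ) - t|} ≤ ENNReal.ofReal (t / c ^ 2) := by
  have hlaw : P.map (N t) = poissonMeasure t := by
    have h := hN.law 0 t zero_le
    rw [tsub_zero] at h
    rw [← h]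
    refine Measure.map_congr ?_
    filter_upwards [hN.zero] with ω hω
    rw [hω, Nat.sub_zero]
  have h := poissonMeasure_le_abs_sub t hc
  rwa [← hlaw, Measure.map_apply (hN.measurable t) MeasurableSet.of_discrete] at h

end Poisson

/-! ### Choice of parameters for large `n` -/

/-- If `K > 2 * x`, then `K / 2` is a closer power of two. -/
lemma IsClosestDyadic.le_two_mul {K : ℕ} {x : ℝ} (hK : IsClosestDyadic K x) (hx : 1 ≤ x) :
    (K : ℝ) ≤ 2 * x := by
  obtain ⟨⟨m, rfl⟩, hmin⟩ := hK
  rcases m with _ | m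
  · norm_num
    linarith
  · by_contra! h
    have h1 := hmin m
    push_cast at h h1
    rw [pow_succ] at h h1
    have h2 : x < 2 ^ m := by linarith
    rw [abs_of_pos (by linarith), abs_of_pos (by linarith)] at h1
    have : (0 : ℝ) < 2 ^ m := by positivity
    linarith

/-- The sizes of the parameters for which the tail bounds of the strip counts are effective. -/
structure IsLarge (k : ℕ) (χ : ℝ) (n : ℕ) : Prop where
  log_ge : 5 ≤ Real.log n
  exp_le : 2 + Real.log n * Real.exp (k + 1) ≤ Real.exp (-4) * Real.log n ^ 2
  sq_log_ge : (k + 5) * Real.log n + k ≤ Real.log n ^ 2 / 2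
  rpow_le : 128 * k * Real.log n ^ 3 * (n : ℝ) ^ χ ≤ n
  four_mul_le : 4 * k ≤ n
  log_le : Real.log n + 1 ≤ n

lemma eventually_isLarge (k : ℕ) {χ : ℝ} (hχ : χ < 1) : ∀ᶠ n : ℕ in atTop, IsLarge k χ n := by
  have hlog : Tendsto (fun n : ℕ => Real.log n) atTop atTop :=
    Real.tendsto_log_atTop.comp tendsto_natCast_atTop_atTop
  have hcast : Tendsto (fun n : ℕ => (n : ℝ)) atTop atTop := tendsto_natCast_atTop_atTop
  have h4 : ∀ᶠ n : ℕ in atTop, 128 * k * Real.log n ^ 3 * (n : ℝ) ^ χ ≤ n := by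
    have ho := (isLittleO_log_rpow_rpow_atTop (3 : ℝ) (sub_pos.mpr hχ)).def
      (c := (128 * (k : ℝ) + 1)⁻¹) (by positivity)
    filter_upwards [hcast.eventually ho, hlog.eventually_ge_atTop 1, eventually_gt_atTop 0]
      with n hn hl hpos
    have hn0 : (0 : ℝ) < n := by exact_mod_cast hpos
    have hl3 : Real.log n ^ (3 : ℝ) = Real.log n ^ 3 := by
      rw [← Real.rpow_natCast]; norm_num
    rw [hl3, Real.norm_of_nonneg (by positivity), Real.norm_of_nonneg (by positivity),
      inv_mul_eq_div, le_div_iff₀ (by positivity)] at hn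
    have hpow : (n : ℝ) ^ (1 - χ) * (n : ℝ) ^ χ = n := by
      rw [← Real.rpow_add hn0, sub_add_cancel, Real.rpow_one]
    have hx : (0 : ℝ) ≤ (n : ℝ) ^ χ := by positivity
    have hl3' : (0 : ℝ) ≤ Real.log n ^ 3 := by positivity
    calc _ ≤ (Real.log n ^ 3 * (128 * k + 1)) * (n : ℝ) ^ χ := by
          refine mul_le_mul_of_nonneg_right ?_ hx
          linarith
      _ ≤ (n : ℝ) ^ (1 - χ) * (n : ℝ) ^ χ := mul_le_mul_of_nonneg_right hn hx
      _ = n := hpow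
  set E := Real.exp ((k : ℝ) + 1) with hE
  have hE0 : 0 < E := Real.exp_pos _
  filter_upwards [h4, hlog.eventually_ge_atTop 5, hlog.eventually_ge_atTop (Real.exp 4 * (2 + E)),
    hlog.eventually_ge_atTop (2 * (2 * k + 5)), eventually_ge_atTop (4 * k), eventually_gt_atTop 0]
    with n h4 hl5 hlE hlk hnk hpos
  refine ⟨hl5, ?_, ?_, h4, hnk, ?_⟩
  · have h44 : Real.exp (-4) * Real.exp 4 = 1 := by rw [← Real.exp_add]; simp
    have he : 0 < Real.exp (-4) := Real.exp_pos _
    have h1 : 2 + E ≤ Real.exp (-4) * Real.log n := by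
      calc 2 + E = Real.exp (-4) * (Real.exp 4 * (2 + E)) := by rw [← mul_assoc, h44, one_mul]
        _ ≤ _ := mul_le_mul_of_nonneg_left hlE he.le
    have h2 := mul_le_mul_of_nonneg_right h1 (by linarith : (0 : ℝ) ≤ Real.log n)
    nlinarith
  · have hk0 : (0 : ℝ) ≤ k := k.cast_nonneg
    nlinarith
  · have hn0 : (0 : ℝ) < n := by exact_mod_cast hpos
    linarith [Real.log_le_sub_one_of_pos hn0]

set_option maxHeartbeats 400000 in
/-- For large `n`, every strip count up to size `4 n ^ χ` has polynomially small upper tail after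
`m` steps, as soon as `m` is close to `n log n / k`. -/
lemma IsLarge.avg_stripCount_le {k n : ℕ} {χ : ℝ} (h : IsLarge k χ n) (hχ : 0 < χ) (hk : 2 ≤ k)
    {u : Equiv.Perm (Fin n) → ℝ} (hu : StepLaw k u) {m j : ℕ}
    (hm : (k : ℝ)⁻¹ * (n * (Real.log n - Real.log (Real.log n))) - n ≤ m)
    (hm' : (m : ℝ) ≤ n * Real.log n + n) (hj : (2 : ℝ) ^ j ≤ 4 * (n : ℝ) ^ χ)
    (σ : Equiv.Perm (Fin n)) :
    avg u m (fun w => ind (Real.log n ^ 6 / 2 < stripCount (σ * w.prod) j)) ≤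
      2 / (n : ℝ) ^ 4 := by
  obtain ⟨hl5, hexp, hsq, hpow, hnk, hln⟩ := h
  set l := Real.log n with hl
  have hk2 : (2 : ℝ) ≤ k := by exact_mod_cast hk
  have hnk' : 4 * (k : ℝ) ≤ n := by exact_mod_cast hnk
  have hn0 : (0 : ℝ) < n := by linarith
  have hn1 : (1 : ℝ) ≤ n := by linarith
  have hel : Real.exp l = n := Real.exp_log hn0
  have hx1 : 1 ≤ (n : ℝ) ^ χ := Real.one_le_rpow hn1 hχ.le
  -- The moment order `r ≥ log n` turns a base `exp (-4)` into `n ^ (-4)`. The number `t`, about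
  -- `(log n) ^ 2`, serves both as the bound on moves and as the threshold `L`.
  set r := ⌈l⌉₊ with hr
  set t := ⌈l ^ 2⌉₊ with ht
  have hr1 : l ≤ r := Nat.le_ceil l
  have hr2 : (r : ℝ) ≤ l + 1 := (Nat.ceil_lt_add_one (by linarith)).le
  have ht1 : l ^ 2 ≤ t := Nat.le_ceil _
  have ht2 : (t : ℝ) ≤ l ^ 2 + 1 := (Nat.ceil_lt_add_one (by positivity)).le
  have ht0 : 0 < t := Nat.ceil_pos.mpr (by positivity)
  set Q := r * 2 ^ (j + 1) with hQ
  have hQr : (Q : ℝ) ≤ (l + 1) * (8 * (n : ℝ) ^ χ) := by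
    rw [hQ]
    push_cast
    rw [pow_succ]
    exact mul_le_mul hr2 (by linarith) (by positivity) (by linarith)
  have hpoly : (l + 1) * (l ^ 2 + 1) ≤ 4 * l ^ 3 := by
    have h1 : l + 1 ≤ 2 * l := by linarith
    have h2 : l ^ 2 + 1 ≤ 2 * l ^ 2 := by
      have : 1 ≤ l ^ 2 := one_le_pow₀ (by linarith)
      linarith
    calc (l + 1) * (l ^ 2 + 1) ≤ 2 * l * (2 * l ^ 2) :=
          mul_le_mul h1 h2 (by positivity) (by linarith)
      _ = 4 * l ^ 3 := by ring
  -- The steps lost to revealed trajectories number at most `n / (4 * k)`, so they change `(1 - k /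
  -- n) ^ m` by a bounded factor only.
  have hkQt : k * ((Q : ℝ) * t) ≤ n / 4 := by
    calc k * ((Q : ℝ) * t) ≤ k * ((l + 1) * (8 * (n : ℝ) ^ χ) * (l ^ 2 + 1)) := by gcongr
      _ = 8 * k * (n : ℝ) ^ χ * ((l + 1) * (l ^ 2 + 1)) := by ring
      _ ≤ 8 * k * (n : ℝ) ^ χ * (4 * l ^ 3) := by gcongr
      _ = (128 * k * l ^ 3 * (n : ℝ) ^ χ) / 4 := by ring
      _ ≤ n / 4 := by linarith
  have hQ4 : (Q : ℝ) ≤ n / 4 := by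
    refine le_trans ?_ hkQt
    have h1 : (1 : ℝ) ≤ t := by exact_mod_cast ht0
    have h2 : (0 : ℝ) ≤ Q := Q.cast_nonneg
    calc (Q : ℝ) = 1 * (Q * 1) := by ring
      _ ≤ k * (Q * t) := mul_le_mul (by linarith) (mul_le_mul_of_nonneg_left h1 h2)
          (by linarith) (by linarith)
  have hQk : Q + k ≤ n := by
    have : (Q : ℝ) + k ≤ n := by linarith
    exact_mod_cast this
  refine le_trans (hu.avg_mono m fun w => ind_mono (q := t + 2 * r ≤ stripCount (σ * w.prod) j)
    fun hs => ?_) ((hu.avg_stripCount_le hk (j := j) (r := r) (L := t) (t := t) ht0 hQk m σ).trans ?_)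
  · have h1 : (t : ℝ) + 2 * r ≤ l ^ 6 / 2 := by
      have h2 : l ^ 2 + 1 + 2 * (l + 1) ≤ l ^ 6 / 2 := by
        have h3 : (25 : ℝ) ≤ l ^ 2 := by nlinarith
        have h4 : (625 : ℝ) ≤ l ^ 4 := by nlinarith
        have h5 : l ^ 6 = l ^ 2 * l ^ 4 := by ring
        nlinarith
      linarith
    have h2 := h1.trans hs.le
    exact_mod_cast h2
  · have hfirst : n * (1 + k / n : ℝ) ^ m / 2 ^ t ≤ 1 / (n : ℝ) ^ 4 := by
      have h1 : (1 + k / n : ℝ) ^ m ≤ Real.exp (k * (l + 1)) := by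
        calc (1 + k / n : ℝ) ^ m ≤ Real.exp (k / n) ^ m := by
              refine pow_le_pow_left₀ (by positivity) ?_ m
              linarith [Real.add_one_le_exp ((k : ℝ) / n)]
          _ = Real.exp (m * (k / n)) := (Real.exp_nat_mul _ _).symm
          _ ≤ Real.exp (k * (l + 1)) := by
              refine Real.exp_le_exp.mpr ?_
              rw [← mul_div_assoc, div_le_iff₀ hn0]
              have := mul_le_mul_of_nonneg_left hm' (by linarith : (0 : ℝ) ≤ k)
              linarith
      have h2 : Real.exp (l ^ 2 / 2) ≤ 2 ^ t := by
        calc Real.exp (l ^ 2 / 2) ≤ Real.exp (t * Real.log 2) := by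
              refine Real.exp_le_exp.mpr ?_
              have := Real.log_two_gt_d9
              rw [div_eq_mul_inv]
              exact mul_le_mul ht1 (by linarith) (by norm_num) (by positivity)
          _ = 2 ^ t := by rw [Real.exp_nat_mul, Real.exp_log two_pos]
      have h3 : (n : ℝ) ^ 4 = Real.exp (4 * l) := by
        rw [← hel, ← Real.exp_nat_mul]; norm_num
      rw [div_le_div_iff₀ (by positivity) (by positivity), one_mul, h3]
      calc n * (1 + k / n : ℝ) ^ m * Real.exp (4 * l)
          ≤ Real.exp l * Real.exp (k * (l + 1)) * Real.exp (4 * l) := by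
            rw [hel]; gcongr
        _ = Real.exp (l + k * (l + 1) + 4 * l) := by rw [Real.exp_add, Real.exp_add]
        _ ≤ Real.exp (l ^ 2 / 2) := Real.exp_le_exp.mpr (by linarith)
        _ ≤ 2 ^ t := h2
    have hρ0 : 0 ≤ 1 - (k : ℝ) / n := by
      rw [sub_nonneg, div_le_one hn0]; linarith
    -- In the exponent, `log n - log log n` comes from the lower end of the time window, `k` from
    -- the fluctuation `n` of the clock, and the loss `Q * t` adds at most `1 / 4`.
    have hmain : (1 - k / n : ℝ) ^ (m - Q * t) ≤ l * Real.exp (k + 1) / n := by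
      calc (1 - k / n : ℝ) ^ (m - Q * t) ≤ Real.exp (-(k / n)) ^ (m - Q * t) := by
            refine pow_le_pow_left₀ hρ0 ?_ _
            linarith [Real.add_one_le_exp (-((k : ℝ) / n))]
        _ = Real.exp ((m - Q * t : ℕ) * (-(k / n))) := (Real.exp_nat_mul _ _).symm
        _ ≤ Real.exp (Real.log l + (k + 1) - l) := by
            refine Real.exp_le_exp.mpr ?_
            have h1 : (m : ℝ) - Q * t ≤ (m - Q * t : ℕ) := by
              have h2 : m ≤ (m - Q * t) + Q * t := by omega
              have h3 : (m : ℝ) ≤ (m - Q * t : ℕ) + Q * t := by exact_mod_cast h2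
              linarith
            have h4 : n * (l - Real.log l) - k * n ≤ k * m := by
              have h5 := mul_le_mul_of_nonneg_left hm (by linarith : (0 : ℝ) ≤ k)
              rw [mul_sub, ← mul_assoc, mul_inv_cancel₀ (by linarith), one_mul] at h5
              exact h5
            have h6 : k * ((m : ℝ) - Q * t) ≤ k * (m - Q * t : ℕ) :=
              mul_le_mul_of_nonneg_left h1 (by linarith)
            have h7 : ((m - Q * t : ℕ) : ℝ) * (-(k / n)) = -(k * (m - Q * t : ℕ)) / n := by ring
            rw [h7, div_le_iff₀ hn0]
            linarith
        _ = l * Real.exp (k + 1) / n := by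
            rw [Real.exp_sub, Real.exp_add, Real.exp_log (by linarith), hel]
    have hinv : 1 / ((n : ℝ) - Q - 1) ≤ 2 / n := by
      rw [div_le_div_iff₀ (by linarith) hn0]
      linarith
    have hbase : n * (1 / ((n : ℝ) - Q - 1) + (1 - k / n : ℝ) ^ (m - Q * t)) / t ≤
        Real.exp (-4) := by
      rw [div_le_iff₀ (by positivity)]
      calc n * (1 / ((n : ℝ) - Q - 1) + (1 - k / n : ℝ) ^ (m - Q * t))
          ≤ n * (2 / n + l * Real.exp (k + 1) / n) :=
            mul_le_mul_of_nonneg_left (add_le_add hinv hmain) hn0.le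
        _ = 2 + l * Real.exp (k + 1) := by field_simp
        _ ≤ Real.exp (-4) * l ^ 2 := hexp
        _ ≤ Real.exp (-4) * t := mul_le_mul_of_nonneg_left ht1 (Real.exp_pos _).le
    have hbase0 : 0 ≤ n * (1 / ((n : ℝ) - Q - 1) + (1 - k / n : ℝ) ^ (m - Q * t)) / t := by
      have : 0 < (n : ℝ) - Q - 1 := by linarith
      positivity
    have hsecond : (n * (1 / ((n : ℝ) - Q - 1) + (1 - k / n : ℝ) ^ (m - Q * t)) / t) ^ r ≤
        1 / (n : ℝ) ^ 4 := by
      calc _ ≤ Real.exp (-4) ^ r := pow_le_pow_left₀ hbase0 hbase r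
        _ = Real.exp (r * (-4)) := (Real.exp_nat_mul _ _).symm
        _ ≤ Real.exp (-(4 * l)) := Real.exp_le_exp.mpr (by linarith)
        _ = 1 / (n : ℝ) ^ 4 := by
            rw [Real.exp_neg, one_div, ← hel, ← Real.exp_nat_mul]; norm_num
    calc _ ≤ 1 / (n : ℝ) ^ 4 + 1 / (n : ℝ) ^ 4 := add_le_add hfirst hsecond
      _ = 2 / (n : ℝ) ^ 4 := by ring

/-! ### Union bound and conclusion -/

/-- Quantitative form of the theorem for a single large `n`. -/
lemma IsWalkData.measure_exists_stripCount_le {k n K : ℕ} {χ : ℝ} (hk : 2 ≤ k) (hχ₀ : 0 < χ)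
    (hχ₁ : χ < 1) (hn : IsLarge k χ n) (hK : IsClosestDyadic K ((n : ℝ) ^ χ))
    {Ω : Type*} [MeasurableSpace Ω] {P : Measure Ω} [IsProbabilityMeasure P]
    {π₀ : Ω → Equiv.Perm (Fin n)} {γ : ℕ → Ω → Equiv.Perm (Fin n)} {N : ℝ≥0 → Ω → ℕ}
    (hW : IsWalkData P k n π₀ γ N) :
    P {ω | ∃ t : ℝ≥0,
        (k : ℝ)⁻¹ * (n * (Real.log n - Real.log (Real.log n))) ≤ t ∧
        (t : ℝ) ≤ n * Real.log n ∧
        ∃ j : ℕ, j ≤ Nat.log 2 K + 1 ∧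
          (Real.log n) ^ 6 / 2 < (stripCount (walk π₀ γ N t ω) j : ℝ)} ≤
      ENNReal.ofReal (2 * (Real.log n / n) + 24 / n) := by
  have hprob := hW.isProbabilityMeasure_uniformOn
  have hu : StepLaw k (kCycleLaw k n) := stepLaw_kCycleLaw
  set l := Real.log n with hl
  have hl5 : 5 ≤ l := hn.log_ge
  have hk2 : (2 : ℝ) ≤ k := by exact_mod_cast hk
  have hn8 : (8 : ℝ) ≤ n := by
    have : (4 * k : ℝ) ≤ n := by exact_mod_cast hn.four_mul_le
    linarith
  have hn0 : (0 : ℝ) < n := by linarith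
  set a := (k : ℝ)⁻¹ * (n * (l - Real.log l)) with ha
  set s₀ : ℝ≥0 := a.toNNReal with hs₀
  set s₁ : ℝ≥0 := (n * l).toNNReal with hs₁
  have hs₁v : (s₁ : ℝ) = n * l := Real.coe_toNNReal _ (by positivity)
  have hloglog : 0 ≤ Real.log l := Real.log_nonneg (by linarith)
  have has₀ : a ≤ s₀ := Real.le_coe_toNNReal a
  have hs₀v : (s₀ : ℝ) ≤ n * l := by
    rw [hs₀, Real.coe_toNNReal', max_le_iff]
    refine ⟨?_, by positivity⟩
    have h1 : n * (l - Real.log l) ≤ n * l := mul_le_mul_of_nonneg_left (by linarith) hn0.le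
    calc a ≤ (k : ℝ)⁻¹ * (n * l) := mul_le_mul_of_nonneg_left h1 (by positivity)
      _ ≤ 1 * (n * l) := mul_le_mul_of_nonneg_right (inv_le_one_of_one_le₀ (by linarith))
          (by positivity)
      _ = n * l := one_mul _
  have hχn : (n : ℝ) ^ χ ≤ n := by
    calc (n : ℝ) ^ χ ≤ (n : ℝ) ^ (1 : ℝ) := Real.rpow_le_rpow_of_exponent_le (by linarith) hχ₁.le
      _ = n := Real.rpow_one _
  have hK2 : (K : ℝ) ≤ 2 * (n : ℝ) ^ χ :=
    hK.le_two_mul (Real.one_le_rpow (by linarith) hχ₀.le)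
  have hK0 : K ≠ 0 := by
    obtain ⟨⟨i, rfl⟩, -⟩ := hK
    positivity
  -- The deterministic constraints are part of the event, so it is empty for irrelevant pairs and
  -- the bound holds for all `m` and `j`.
  set Bad : ℕ → ℕ → Set Ω := fun m j => {ω | a - n ≤ m ∧ (m : ℝ) ≤ n * l + n ∧
    (2 : ℝ) ^ j ≤ 4 * (n : ℝ) ^ χ ∧
    l ^ 6 / 2 < (stripCount (π₀ ω * ((List.range m).map fun i => γ i ω).prod) j : ℝ)} with hBad
  have hBadP : ∀ m j, P (Bad m j) ≤ ENNReal.ofReal (2 / (n : ℝ) ^ 4) := by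
    intro m j
    by_cases hc : a - n ≤ m ∧ (m : ℝ) ≤ n * l + n ∧ (2 : ℝ) ^ j ≤ 4 * (n : ℝ) ^ χ
    · have h := hW.measureReal_le m (fun σ w => l ^ 6 / 2 < (stripCount (σ * w.prod) j : ℝ))
        fun σ => hn.avg_stripCount_le hχ₀ hk hu hc.1 hc.2.1 hc.2.2 σ
      have hsub : Bad m j ⊆ {ω | l ^ 6 / 2 < (stripCount (π₀ ω *
          ((List.range m).map fun i => γ i ω).prod) j : ℝ)} := fun ω hω => hω.2.2.2
      refine (measure_mono hsub).trans ?_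
      rw [← ENNReal.ofReal_toReal (measure_ne_top P _)]
      exact ENNReal.ofReal_le_ofReal h
    · have : Bad m j = ∅ := Set.eq_empty_of_forall_notMem fun ω hω =>
        hc ⟨hω.1, hω.2.1, hω.2.2.1⟩
      rw [this, measure_empty]
      exact bot_le
  set E₀ : Set Ω := {ω | (n : ℝ) ≤ |(N s₀ ω : ℝ) - s₀|}
  set E₁ : Set Ω := {ω | (n : ℝ) ≤ |(N s₁ ω : ℝ) - s₁|}
  -- A crude box of order `n ^ 3` pairs is enough against `n ^ (-4)`.
  set I : Finset (ℕ × ℕ) := Finset.range (n ^ 2 + 1) ×ˢ Finset.range (2 * n + 2)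
  have hsub : {ω | ∃ t : ℝ≥0, a ≤ t ∧ (t : ℝ) ≤ n * l ∧ ∃ j : ℕ, j ≤ Nat.log 2 K + 1 ∧
      l ^ 6 / 2 < (stripCount (walk π₀ γ N t ω) j : ℝ)} ⊆
      {ω | ¬ Monotone fun t => N t ω} ∪ (E₀ ∪ (E₁ ∪ ⋃ i ∈ I, Bad i.1 i.2)) := by
    rintro ω ⟨t, hat, htn, j, hj, hlt⟩
    by_cases hmono : Monotone fun t => N t ω
    swap
    · exact Or.inl hmono
    by_cases h0 : ω ∈ E₀
    · exact Or.inr (Or.inl h0)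
    by_cases h1 : ω ∈ E₁
    · exact Or.inr (Or.inr (Or.inl h1))
    refine Or.inr (Or.inr (Or.inr ?_))
    have h0' : |(N s₀ ω : ℝ) - s₀| < n := not_le.mp h0
    have h1' : |(N s₁ ω : ℝ) - s₁| < n := not_le.mp h1
    -- Monotone paths make concentration at the two endpoints control every time in between.
    have hm0 : (N s₀ ω : ℝ) ≤ N t ω := by
      exact_mod_cast hmono (Real.toNNReal_le_iff_le_coe.mpr hat)
    have hm1 : (N t ω : ℝ) ≤ N s₁ ω := by
      exact_mod_cast hmono (NNReal.coe_le_coe.mp (htn.trans hs₁v.ge))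
    have hlow : a - n ≤ N t ω := by
      have := (abs_lt.mp h0').1
      linarith
    have hupp : (N t ω : ℝ) ≤ n * l + n := by
      have := (abs_lt.mp h1').2
      linarith
    have h2j : 2 ^ j ≤ 2 * K := by
      calc 2 ^ j ≤ 2 ^ (Nat.log 2 K + 1) := Nat.pow_le_pow_right two_pos hj
        _ = 2 * 2 ^ Nat.log 2 K := by rw [pow_succ, mul_comm]
        _ ≤ 2 * K := Nat.mul_le_mul_left 2 (Nat.pow_log_le_self 2 hK0)
    have h2j' : (2 : ℝ) ^ j ≤ 4 * (n : ℝ) ^ χ := by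
      have : ((2 ^ j : ℕ) : ℝ) ≤ (2 * K : ℕ) := by exact_mod_cast h2j
      push_cast at this
      linarith
    refine Set.mem_biUnion (x := (N t ω, j)) ?_ ⟨hlow, hupp, h2j', hlt⟩
    refine Finset.mem_coe.mpr (Finset.mem_product.mpr ⟨Finset.mem_range.mpr ?_,
      Finset.mem_range.mpr ?_⟩)
    · have h : (N t ω : ℝ) ≤ (n ^ 2 : ℕ) := by
        push_cast
        calc (N t ω : ℝ) ≤ n * (l + 1) := by linarith
          _ ≤ n * n := mul_le_mul_of_nonneg_left hn.log_le hn0.le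
          _ = (n : ℝ) ^ 2 := (sq _).symm
      exact Nat.lt_succ_of_le (by exact_mod_cast h)
    · have h1 : Nat.log 2 K < K := Nat.log_lt_self 2 hK0
      have h2 : K ≤ 2 * n := by
        have : (K : ℝ) ≤ 2 * n := by linarith
        exact_mod_cast this
      show j < 2 * n + 2
      omega
  have hmono0 : P {ω | ¬ Monotone fun t => N t ω} = 0 := ae_iff.mp hW.poisson.monotone
  have hE : ∀ s : ℝ≥0, (s : ℝ) ≤ n * l →
      P {ω | (n : ℝ) ≤ |(N s ω : ℝ) - s|} ≤ ENNReal.ofReal (l / n) := by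
    intro s hs
    refine (hW.poisson.measure_le_abs_sub s hn0).trans (ENNReal.ofReal_le_ofReal ?_)
    rw [div_le_div_iff₀ (by positivity) hn0]
    nlinarith
  have hU : P (⋃ i ∈ I, Bad i.1 i.2) ≤ ENNReal.ofReal (24 / n) := by
    refine (measure_biUnion_finset_le I _).trans
      ((Finset.sum_le_sum fun i _ => hBadP i.1 i.2).trans ?_)
    rw [Finset.sum_const, nsmul_eq_mul, ← ENNReal.ofReal_natCast,
      ← ENNReal.ofReal_mul (Nat.cast_nonneg _)]
    refine ENNReal.ofReal_le_ofReal ?_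
    rw [Finset.card_product, Finset.card_range, Finset.card_range]
    push_cast
    rw [mul_div_assoc', div_le_div_iff₀ (by positivity) hn0]
    have h1 : (n : ℝ) ^ 2 + 1 ≤ 2 * n ^ 2 := by nlinarith
    have h2 : 2 * (n : ℝ) + 2 ≤ 3 * n := by linarith
    calc ((n : ℝ) ^ 2 + 1) * (2 * n + 2) * 2 * n ≤ 2 * n ^ 2 * (3 * n) * 2 * n := by gcongr
      _ ≤ 24 * (n : ℝ) ^ 4 := by nlinarith [pow_pos hn0 4]
  calc _ ≤ P ({ω | ¬ Monotone fun t => N t ω} ∪ (E₀ ∪ (E₁ ∪ ⋃ i ∈ I, Bad i.1 i.2))) :=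
        measure_mono hsub
    _ ≤ 0 + (ENNReal.ofReal (l / n) + (ENNReal.ofReal (l / n) + ENNReal.ofReal (24 / n))) := by
        refine (measure_union_le _ _).trans (add_le_add hmono0.le ?_)
        refine (measure_union_le _ _).trans (add_le_add (hE s₀ hs₀v) ?_)
        exact (measure_union_le _ _).trans (add_le_add (hE s₁ hs₁v.le) hU)
    _ = ENNReal.ofReal (2 * (l / n) + 24 / n) := by
        rw [zero_add, ← ENNReal.ofReal_add (by positivity) (by positivity),
          ← ENNReal.ofReal_add (by positivity) (by positivity)]
        congr 1
        ring

end RandomKCycles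

theorem proposition11 (k : ℕ) (hk : 2 ≤ k) (χ : ℝ) (hχ₀ : 0 < χ) (hχ₁ : χ < 1)
    (K : ℕ → ℕ) (hK : ∀ n : ℕ, RandomKCycles.IsClosestDyadic (K n) ((n : ℝ) ^ χ))
    (Ω : ℕ → Type*) [∀ n, MeasurableSpace (Ω n)]
    (P : ∀ n, Measure (Ω n)) [∀ n, IsProbabilityMeasure (P n)]
    (π₀ : ∀ n, Ω n → Equiv.Perm (Fin n))
    (γ : ∀ n, ℕ → Ω n → Equiv.Perm (Fin n))
    (N : ∀ n, ℝ≥0 → Ω n → ℕ)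
    (hwalk : ∀ n, k ≤ n → RandomKCycles.IsWalkData (P n) k n (π₀ n) (γ n) (N n)) :
    Tendsto
      (fun n : ℕ => P n {ω | ∃ t : ℝ≥0,
        (k : ℝ)⁻¹ * (n * (Real.log n - Real.log (Real.log n))) ≤ t ∧
        (t : ℝ) ≤ n * Real.log n ∧
        ∃ j : ℕ, j ≤ Nat.log 2 (K n) + 1 ∧
          (Real.log n) ^ 6 / 2 <
            (RandomKCycles.stripCount
              (RandomKCycles.walk (π₀ n) (γ n) (N n) t ω) j : ℝ)})
      atTop (𝓝 0) := by
  have hcast : Tendsto (fun n : ℕ => (n : ℝ)) atTop atTop := tendsto_natCast_atTop_atTop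
  have hlog : Tendsto (fun n : ℕ => Real.log n / n) atTop (𝓝 0) :=
    (Real.isLittleO_log_id_atTop.tendsto_div_nhds_zero).comp hcast
  have hlim : Tendsto (fun n : ℕ => ENNReal.ofReal (2 * (Real.log n / n) + 24 / n)) atTop
      (𝓝 0) := by
    have h := (hlog.const_mul 2).add (hcast.const_div_atTop 24)
    rw [mul_zero, add_zero] at h
    simpa using ENNReal.tendsto_ofReal h
  refine tendsto_of_tendsto_of_tendsto_of_le_of_le' tendsto_const_nhds hlim
    (Eventually.of_forall fun n => bot_le) ?_
  filter_upwards [RandomKCycles.eventually_isLarge k hχ₁, eventually_ge_atTop k] with n hn hkn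
  exact (hwalk n hkn).measure_exists_stripCount_le hk hχ₀ hχ₁ hn (hK n)
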